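/- Let $-1<q<1$ and let $\mathcal H=\ell^2(\mathbb Z)$ (complex), with canonical basis $(e_i)_{i\in\mathbb Z}$. Let $\Gamma_q(\mathcal H)$ be the $q$-deformed Fock space, i.e. the completion of the linear span of the vacuum vector $\Omega$ and of the simple tensors $f_1\otimes\cdots\otimes f_n$, $f_j\in\mathcal H$, $n\ge 1$, with respect to the inner product $$\langle f_1\otimes\cdots\otimes f_n,\,g_1\otimes\cdots\otimes g_m\rangle_q=\delta_{n,m}\sum_{\pi}q^{i(\pi)}\prod_{k=1}^n\langle f_k,g_{\pi(k)}\rangle ,$$ where $\pi$ runs over the permutations of $\{1,\dots,n\}$ and $i(\pi)$ is the number of inversions of $\pi$ (and $\|\Omega\|=1$). On it consider the bounded operators given by the creators $a_q^\dagger(f)\Omega=f$, $a_q^\dagger(f)f_1\otimes\cdots\otimes f_n=f\otimes f_1\otimes\cdots\otimes f_n$, their adjoints, the annihilators $a_q(f)$, and the self-adjoint parts $s_q(f)=a_q(f)+a_q^\dagger(f)$. Let $\mathfrak R_q$ be the unital $C^*$-algebra generated by $\{a_q(f): f\in\ell^2(\mathbb Z)\}$, let $\mathfrak G_q$ be the unital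 $C^*$-algebra generated by $\{s_q(f): f\in\ell^2(\mathbb Z)\}$, and let $\mathfrak G_q^{\mathbb R}$ be the unital $C^*$-algebra generated by $\{s_q(e_i): i\in\mathbb Z\}$. Let $\mathbb P_{\mathbb Z}$ be the group of the permutations of $\mathbb Z$ that move only finitely many integers. It acts on each of the three algebras by the $*$-automorphisms $\alpha_g$, $g\in\mathbb P_{\mathbb Z}$, implemented by the unitaries $\Gamma_q(U_g)$, $f_1\otimes\cdots\otimes f_n\mapsto U_gf_1\otimes\cdots\otimes U_gf_n$, $\Omega\mapsto\Omega$, where $U_ge_i=e_{g(i)}$; thus $\alpha_g(a_q(e_i))=a_q(e_{g(i)})$ for all $i$. Then, for each of the algebras $\mathfrak A=\mathfrak R_q,\ \mathfrak G_q,\ \mathfrak G_q^{\mathbb R}$, the set of the states $\varphi$ of $\mathfrak A$ with $\varphi\circ\alpha_g=\varphi$ for all $g\in\mathbb P_{\mathbb Z}$ consists of exactly one element, the Fock vacuum expectation $T\mapsto\langle T\Omega,\Omega\rangle$. -/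

import Mathlib

noncomputable section

namespace QFock

open scoped ComplexConjugate

section Algebraic

variable {H : Type*} [NormedAddCommGroup H] [InnerProductSpace ℂ H]

/-- Induction over the tensor algebra by adding one letter on the left. -/
theorem leftInduction {P : TensorAlgebra ℂ H → Prop} (h1 : P 1)
    (hsmul : ∀ (c : ℂ) x, P x → P (c • x))
    (hadd : ∀ x y, P x → P y → P (x + y)) (hmul : ∀ v x, P x → P (TensorAlgebra.ι ℂ v * x)) :
    ∀ x, P x := by
  have key : ∀ a : TensorAlgebra ℂ H, ∀ x, P x → P (a * x) := by
    intro a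
    induction a using TensorAlgebra.induction with
    | algebraMap r => intro x hx; rw [← Algebra.smul_def]; exact hsmul _ _ hx
    | ι v => exact hmul v
    | mul a b ha hb => intro x hx; rw [mul_assoc]; exact ha _ (hb _ hx)
    | add a b ha hb => intro x hx; rw [add_mul]; exact hadd _ _ (ha _ hx) (hb _ hx)
  intro x
  simpa using key x 1 h1

/-- The auxiliary algebra homomorphism sending a letter `v` to the operator
`(x, y) ↦ (v ⊗ x, ⟪f, v⟫ x + q v ⊗ y)`. -/
def annihAux (q : ℝ) (f : H) :
    TensorAlgebra ℂ H →ₐ[ℂ] Module.End ℂ (TensorAlgebra ℂ H × TensorAlgebra ℂ H) :=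
  TensorAlgebra.lift ℂ
    { toFun := fun v =>
        LinearMap.prod
          (LinearMap.mulLeft ℂ (TensorAlgebra.ι ℂ v) ∘ₗ LinearMap.fst ℂ _ _)
          (inner ℂ f v • LinearMap.fst ℂ _ _ +
            (q : ℂ) • (LinearMap.mulLeft ℂ (TensorAlgebra.ι ℂ v) ∘ₗ LinearMap.snd ℂ _ _))
      map_add' := by
        intro v w
        refine LinearMap.ext fun p => Prod.ext ?_ ?_
        · simp [add_mul]
        · simp [add_mul, add_smul]; abel
      map_smul' := by
        intro c v
        refine LinearMap.ext fun p => Prod.ext ?_ ?_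
        · simp
        · simp [mul_smul, smul_add, smul_comm c q] }

/-- The algebraic annihilator `a_q(f)` on the tensor algebra. It is the linear map determined by
`a_q(f) Ω = 0` and `a_q(f) (v ⊗ x) = ⟪f, v⟫ x + q v ⊗ a_q(f) x`; the closed formula on simple
tensors is `annih_tprod`. -/
def annih (q : ℝ) (f : H) : TensorAlgebra ℂ H →ₗ[ℂ] TensorAlgebra ℂ H :=
  LinearMap.snd ℂ _ _ ∘ₗ LinearMap.applyₗ (1, 0) ∘ₗ (annihAux q f).toLinearMap

variable (q : ℝ)

theorem annihAux_fst (f : H) (x : TensorAlgebra ℂ H) : (annihAux q f x (1, 0)).1 = x := by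
  induction x using leftInduction with
  | h1 => simp
  | hsmul c x hx => simp [hx]
  | hadd x y hx hy => simp [hx, hy]
  | hmul v x hx =>
    rw [map_mul, Module.End.mul_apply]
    generalize annihAux q f x (1, 0) = p at hx
    simp [annihAux, hx]

@[simp] theorem annih_one (f : H) : annih q f 1 = 0 := by simp [annih]

@[simp] theorem annih_ι_mul (f v : H) (x : TensorAlgebra ℂ H) :
    annih q f (TensorAlgebra.ι ℂ v * x) =
      inner ℂ f v • x + (q : ℂ) • (TensorAlgebra.ι ℂ v * annih q f x) := by
  have h := annihAux_fst q f x
  simp only [annih, LinearMap.comp_apply, AlgHom.toLinearMap_apply, LinearMap.applyₗ_apply_apply,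
    map_mul, Module.End.mul_apply, LinearMap.snd_apply]
  generalize annihAux q f x (1, 0) = p at h ⊢
  simp [annihAux, h]

theorem annih_add (f g : H) : annih q (f + g) = annih q f + annih q g := by
  refine LinearMap.ext fun x => ?_
  induction x using leftInduction with
  | h1 => simp
  | hsmul c x hx => simp [hx]
  | hadd x y hx hy => simp only [map_add, hx, hy]
  | hmul v x hx =>
    rw [LinearMap.add_apply, annih_ι_mul, annih_ι_mul, annih_ι_mul, hx, LinearMap.add_apply,
      inner_add_left, add_smul, mul_add, smul_add]
    abel

theorem annih_smul (c : ℂ) (f : H) : annih q (c • f) = conj c • annih q f := by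
  refine LinearMap.ext fun x => ?_
  induction x using leftInduction with
  | h1 => simp
  | hsmul c x hx => simp only [map_smul, hx]
  | hadd x y hx hy => simp only [map_add, hx, hy]
  | hmul v x hx =>
    rw [LinearMap.smul_apply, annih_ι_mul, annih_ι_mul, hx, LinearMap.smul_apply,
      inner_smul_left, mul_smul, smul_add, mul_smul_comm, smul_comm (q : ℂ)]

theorem tprod_succ {n : ℕ} (f : Fin (n + 1) → H) :
    TensorAlgebra.tprod ℂ H (n + 1) f =
      TensorAlgebra.ι ℂ (f 0) * TensorAlgebra.tprod ℂ H n (fun i => f i.succ) := by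
  simp [TensorAlgebra.tprod_apply]

theorem tprod_zero (f : Fin 0 → H) : TensorAlgebra.tprod ℂ H 0 f = 1 := by
  simp [TensorAlgebra.tprod_apply]

/-- The annihilator removes the letters one by one, the `k`-th one (counted from zero) with the
factor `q ^ k`. -/
theorem annih_tprod (g : H) {n : ℕ} (f : Fin (n + 1) → H) :
    annih q g (TensorAlgebra.tprod ℂ H (n + 1) f) =
      ∑ k : Fin (n + 1), ((q : ℂ) ^ (k : ℕ) * inner ℂ g (f k)) •
        TensorAlgebra.tprod ℂ H n (fun i => f (k.succAbove i)) := by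
  induction n with
  | zero =>
    rw [tprod_succ, annih_ι_mul]
    simp
  | succ n ih =>
    rw [tprod_succ, annih_ι_mul, ih,
      Fin.sum_univ_succ (n := n + 1) (f := fun k => ((q : ℂ) ^ (k : ℕ) * inner ℂ g (f k)) •
        TensorAlgebra.tprod ℂ H (n + 1) (fun i => f (k.succAbove i)))]
    simp only [Fin.val_zero, pow_zero, one_mul, Fin.zero_succAbove]
    congr 1
    rw [Finset.mul_sum, Finset.smul_sum]
    refine Finset.sum_congr rfl fun k _ => ?_
    rw [tprod_succ, mul_smul_comm, smul_smul]
    simp [pow_succ', mul_assoc]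

/-- The vacuum component `x ↦ conj ⟨Ω, x⟩` on the tensor algebra. -/
def vacConj : TensorAlgebra ℂ H →ₗ⋆[ℂ] ℂ :=
  (starLinearEquiv ℂ (A := ℂ)).toLinearMap.comp
    (TensorAlgebra.algebraMapInv (R := ℂ) (M := H)).toLinearMap

@[simp] theorem vacConj_one : vacConj (1 : TensorAlgebra ℂ H) = 1 := by simp [vacConj]

@[simp] theorem vacConj_ι_mul (v : H) (x : TensorAlgebra ℂ H) :
    vacConj (TensorAlgebra.ι ℂ v * x) = 0 := by
  simp [vacConj, TensorAlgebra.algebraMapInv]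

/-- Letters acting on antilinear functionals by `v ↦ (φ ↦ φ ∘ a_q(v))`. -/
def formAux : TensorAlgebra ℂ H →ₐ[ℂ] Module.End ℂ (TensorAlgebra ℂ H →ₗ⋆[ℂ] ℂ) :=
  TensorAlgebra.lift ℂ
    { toFun := fun v =>
        { toFun := fun φ => φ.comp (annih q v)
          map_add' := fun _ _ => rfl
          map_smul' := fun _ _ => rfl }
      map_add' := by
        intro v w
        refine LinearMap.ext fun φ => LinearMap.ext fun x => ?_
        simp [annih_add]
      map_smul' := by
        intro c v
        refine LinearMap.ext fun φ => LinearMap.ext fun x => ?_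
        simp [annih_smul] }

/-- The `q`-deformed sesquilinear form on the tensor algebra (antilinear in the first variable).
It is the sesquilinear form whose values on simple tensors are
`⟨f₁ ⊗ ⋯ ⊗ fₙ, g₁ ⊗ ⋯ ⊗ gₘ⟩ = δ_{n,m} ∑_π q ^ i(π) ∏ i, ⟪f_i, g_{π i}⟫`, see `qForm_tprod` and
`qForm_tprod_of_ne`. -/
def qForm (x y : TensorAlgebra ℂ H) : ℂ := formAux q y vacConj x

theorem qForm_add_left (x y z : TensorAlgebra ℂ H) :
    qForm q (x + y) z = qForm q x z + qForm q y z := by simp [qForm]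
theorem qForm_add_right (x y z : TensorAlgebra ℂ H) :
    qForm q x (y + z) = qForm q x y + qForm q x z := by simp [qForm]
theorem qForm_smul_left (c : ℂ) (x y : TensorAlgebra ℂ H) :
    qForm q (c • x) y = conj c * qForm q x y := by simp [qForm]
theorem qForm_smul_right (c : ℂ) (x y : TensorAlgebra ℂ H) :
    qForm q x (c • y) = c * qForm q x y := by simp [qForm]
theorem qForm_one_right (x : TensorAlgebra ℂ H) : qForm q x 1 = vacConj x := by simp [qForm]
theorem qForm_zero_left (y : TensorAlgebra ℂ H) : qForm q 0 y = 0 := by simp [qForm]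

theorem qForm_ι_mul_right (v : H) (x y : TensorAlgebra ℂ H) :
    qForm q x (TensorAlgebra.ι ℂ v * y) = qForm q (annih q v x) y := by
  simp [qForm, formAux]

theorem qForm_ι_mul_left (v : H) (x y : TensorAlgebra ℂ H) :
    qForm q (TensorAlgebra.ι ℂ v * x) y = qForm q x (annih q v y) := by
  induction y using leftInduction generalizing x with
  | h1 => simp [qForm]
  | hsmul c y hy => simp [qForm_smul_right, hy]
  | hadd y z hy hz => simp [qForm_add_right, hy, hz]
  | hmul w y hy =>
    rw [qForm_ι_mul_right, annih_ι_mul, annih_ι_mul, qForm_add_left, qForm_add_right,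
      qForm_smul_left, qForm_smul_left, qForm_smul_right, qForm_smul_right, qForm_ι_mul_right, hy,
      inner_conj_symm, Complex.conj_ofReal]

theorem qForm_conj (x y : TensorAlgebra ℂ H) : conj (qForm q y x) = qForm q x y := by
  induction y using leftInduction generalizing x with
  | h1 =>
    rw [qForm_one_right]
    induction x using leftInduction with
    | h1 => simp [qForm]
    | hsmul c x hx => simp [qForm_smul_right, hx]
    | hadd x y hx hy => simp [qForm_add_right, hx, hy]
    | hmul v x hx => simp [qForm_ι_mul_right, qForm_zero_left]
  | hsmul c y hy => simp [qForm_smul_right, qForm_smul_left, hy]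
  | hadd y z hy hz => simp [qForm_add_right, qForm_add_left, hy, hz]
  | hmul w y hy => rw [qForm_ι_mul_right, qForm_ι_mul_left, hy]

end Algebraic

section Inversions

/-- The number of inversions of a permutation. -/
def inversions {n : ℕ} (π : Equiv.Perm (Fin n)) : ℕ :=
  (Finset.univ.filter fun p : Fin n × Fin n => p.1 < p.2 ∧ π p.2 < π p.1).card

/-- The permutation of `{0, …, n}` sending `k` to `0` and inducing `π` on the remaining points. -/
def insertPerm {n : ℕ} (k : Fin (n + 1)) (π : Equiv.Perm (Fin n)) : Equiv.Perm (Fin (n + 1)) :=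
  (finSuccEquiv' k).trans ((Equiv.optionCongr π).trans (finSuccEquiv' 0).symm)

@[simp] theorem insertPerm_self {n : ℕ} (k : Fin (n + 1)) (π : Equiv.Perm (Fin n)) :
    insertPerm k π k = 0 := by
  simp [insertPerm]

@[simp] theorem insertPerm_succAbove {n : ℕ} (k : Fin (n + 1)) (π : Equiv.Perm (Fin n))
    (i : Fin n) : insertPerm k π (k.succAbove i) = (π i).succ := by
  simp [insertPerm]

theorem insertPerm_bijective (n : ℕ) :
    Function.Bijective fun p : Fin (n + 1) × Equiv.Perm (Fin n) => insertPerm p.1 p.2 := by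
  rw [Fintype.bijective_iff_injective_and_card]
  constructor
  · rintro ⟨k, π⟩ ⟨l, ρ⟩ h
    have h : insertPerm k π = insertPerm l ρ := h
    have hkl : k = l := by
      apply (insertPerm k π).injective
      rw [insertPerm_self, h, insertPerm_self]
    subst hkl
    refine Prod.ext rfl (Equiv.ext fun i => ?_)
    have := congrArg (fun e : Equiv.Perm _ => e (k.succAbove i)) h
    simpa using this
  · simp [Fintype.card_perm, Nat.factorial_succ]

theorem inversions_eq_sum {n : ℕ} (π : Equiv.Perm (Fin n)) :
    inversions π = ∑ a, ∑ b, if a < b ∧ π b < π a then 1 else 0 := by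
  rw [inversions, Finset.card_filter, Fintype.sum_prod_type]

theorem inversions_insertPerm {n : ℕ} (k : Fin (n + 1)) (π : Equiv.Perm (Fin n)) :
    inversions (insertPerm k π) = k + inversions π := by
  have hk : (∑ i : Fin n, if k.succAbove i < k then 1 else 0) = (k : ℕ) := by
    have h : (∑ a : Fin (n + 1), if a < k then 1 else 0) = (k : ℕ) := by
      rw [← Finset.card_filter, Finset.filter_gt_eq_Iio, Fin.card_Iio]
    rw [Fin.sum_univ_succAbove _ k] at h
    simpa using h
  rw [inversions_eq_sum, inversions_eq_sum, Fin.sum_univ_succAbove _ k]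
  have h1 : (∑ b, if k < b ∧ insertPerm k π b < insertPerm k π k then 1 else 0) = 0 := by simp
  rw [h1, zero_add]
  have h2 : ∀ i : Fin n, (∑ b, if k.succAbove i < b ∧
      insertPerm k π b < insertPerm k π (k.succAbove i) then 1 else 0) =
      (if k.succAbove i < k then 1 else 0) + ∑ j, if i < j ∧ π j < π i then 1 else 0 := by
    intro i
    rw [Fin.sum_univ_succAbove _ k]
    simp [Fin.succAbove_lt_succAbove_iff]
  simp_rw [h2]
  rw [Finset.sum_add_distrib, hk]

/-- The number of inversions of `τ σ⁻¹` is the number of pairs on which `σ` and `τ` differ. -/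
theorem inversions_mul_inv {n : ℕ} (σ τ : Equiv.Perm (Fin n)) :
    inversions (τ * σ⁻¹) = (Finset.univ.filter fun p : Fin n × Fin n =>
      p.1 < p.2 ∧ ¬(σ p.1 < σ p.2 ↔ τ p.1 < τ p.2)).card := by
  have hne : ∀ (ρ : Equiv.Perm (Fin n)) {a b : Fin n}, a ≠ b → ρ a < ρ b ∨ ρ b < ρ a :=
    fun ρ a b h => lt_or_gt_of_ne (fun e => h (ρ.injective e))
  rw [inversions]
  refine Finset.card_bij'
    (fun p _ => if σ.symm p.1 < σ.symm p.2 then (σ.symm p.1, σ.symm p.2)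
      else (σ.symm p.2, σ.symm p.1))
    (fun p _ => if σ p.1 < σ p.2 then (σ p.1, σ p.2) else (σ p.2, σ p.1)) ?_ ?_ ?_ ?_
  · rintro ⟨a, b⟩ h
    rw [Finset.mem_filter] at h ⊢
    simp only [Finset.mem_univ, true_and, Equiv.Perm.mul_apply, Equiv.Perm.inv_def] at h ⊢
    have h3 := hne σ.symm h.1.ne
    split_ifs with h1
    · simp [h1, h.1, h.2.le]
    · have h3 := h3.resolve_left h1
      simp [h3, h.1.le, h.2]
  · rintro ⟨a, b⟩ h
    rw [Finset.mem_filter] at h ⊢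
    simp only [Finset.mem_univ, true_and, Equiv.Perm.mul_apply, Equiv.Perm.inv_def] at h ⊢
    have h3 := hne σ h.1.ne
    have h4 := hne τ h.1.ne
    split_ifs with h1
    · simp only [h1, true_iff] at h
      simpa [h1] using h4.resolve_left h.2
    · simp only [h1, false_iff, not_not] at h
      simpa [h.2] using h3.resolve_left h1
  · rintro ⟨a, b⟩ h
    rw [Finset.mem_filter] at h
    replace h := h.2
    by_cases h1 : σ.symm a < σ.symm b
    · simp [h1, h.1]
    · simp [h1, h.1.not_gt]
  · rintro ⟨a, b⟩ h
    rw [Finset.mem_filter] at h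
    replace h := h.2
    by_cases h1 : σ a < σ b
    · simp [h1, h.1]
    · simp [h1, h.1.not_gt]

end Inversions

section Form

variable {H : Type*} [NormedAddCommGroup H] [InnerProductSpace ℂ H] (q : ℝ)

theorem qForm_sum_left {ι : Type*} (s : Finset ι) (x : ι → TensorAlgebra ℂ H)
    (y : TensorAlgebra ℂ H) : qForm q (∑ i ∈ s, x i) y = ∑ i ∈ s, qForm q (x i) y := by
  simp [qForm]

theorem qForm_sum_right {ι : Type*} (s : Finset ι) (x : TensorAlgebra ℂ H)
    (y : ι → TensorAlgebra ℂ H) : qForm q x (∑ i ∈ s, y i) = ∑ i ∈ s, qForm q x (y i) := by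
  simp [qForm]

/-- Tensors of different lengths are orthogonal. -/
theorem qForm_tprod_of_ne {n m : ℕ} (h : n ≠ m) (f : Fin n → H) (g : Fin m → H) :
    qForm q (TensorAlgebra.tprod ℂ H n f) (TensorAlgebra.tprod ℂ H m g) = 0 := by
  induction m generalizing n with
  | zero =>
    obtain ⟨n, rfl⟩ := Nat.exists_eq_succ_of_ne_zero h
    rw [tprod_zero, tprod_succ, qForm_one_right, vacConj_ι_mul]
  | succ m ih =>
    rw [tprod_succ, qForm_ι_mul_right]
    cases n with
    | zero => rw [tprod_zero, annih_one, qForm_zero_left]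
    | succ n =>
      rw [annih_tprod, qForm_sum_left]
      refine Finset.sum_eq_zero fun k _ => ?_
      rw [qForm_smul_left, ih (by omega), mul_zero]

/-- The `q`-deformed inner product of two simple tensors of the same length. -/
theorem qForm_tprod {n : ℕ} (f g : Fin n → H) :
    qForm q (TensorAlgebra.tprod ℂ H n f) (TensorAlgebra.tprod ℂ H n g) =
      ∑ π : Equiv.Perm (Fin n), (q : ℂ) ^ inversions π * ∏ i, inner ℂ (f i) (g (π i)) := by
  induction n with
  | zero => simp [qForm_one_right, inversions]
  | succ n ih =>
    rw [tprod_succ g, qForm_ι_mul_right, annih_tprod, qForm_sum_left,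
      ← (insertPerm_bijective n).sum_comp, Fintype.sum_prod_type]
    refine Finset.sum_congr rfl fun k _ => ?_
    rw [qForm_smul_left, ih, Finset.mul_sum]
    refine Finset.sum_congr rfl fun π _ => ?_
    rw [inversions_insertPerm, Fin.prod_univ_succAbove _ k]
    simp only [insertPerm_self, insertPerm_succAbove, map_mul, map_pow, Complex.conj_ofReal,
      inner_conj_symm]
    ring

end Form

section Positivity

open Matrix
open scoped ComplexOrder

theorem posSemidef_bool {q : ℝ} (h1 : -1 ≤ q) (h2 : q ≤ 1) :
    (Matrix.of fun a b : Bool => if a = b then (1 : ℂ) else q).PosSemidef := by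
  refine Matrix.PosSemidef.of_dotProduct_mulVec_nonneg ?_ fun x => ?_
  · ext a b
    cases a <;> cases b <;> simp
  · have key : star x ⬝ᵥ ((Matrix.of fun a b : Bool => if a = b then (1 : ℂ) else q) *ᵥ x) =
        (((1 + q) / 2 : ℝ) : ℂ) * (star (x true + x false) * (x true + x false)) +
        (((1 - q) / 2 : ℝ) : ℂ) * (star (x true - x false) * (x true - x false)) := by
      simp [dotProduct, mulVec]
      ring
    rw [key]
    refine add_nonneg (mul_nonneg ?_ (star_mul_self_nonneg _))
      (mul_nonneg ?_ (star_mul_self_nonneg _))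
    · exact Complex.zero_le_real.2 (by linarith)
    · exact Complex.zero_le_real.2 (by linarith)

theorem posSemidef_one' (ι : Type*) [Finite ι] : (Matrix.of fun _ _ : ι => (1 : ℂ)).PosSemidef := by
  have h := Matrix.posSemidef_gram (𝕜 := ℂ) (fun _ : ι => (1 : ℂ))
  have e : (Matrix.of fun _ _ : ι => (1 : ℂ)) = Matrix.gram ℂ fun _ : ι => (1 : ℂ) := by
    ext i j
    simp [Matrix.gram]
  rw [e]
  exact h

theorem posSemidef_prod {ι κ : Type*} [Finite ι] (s : Finset κ) (A : κ → ι → ι → ℂ)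
    (h : ∀ k ∈ s, (Matrix.of (A k)).PosSemidef) :
    (Matrix.of fun i j => ∏ k ∈ s, A k i j).PosSemidef := by
  classical
  induction s using Finset.induction_on with
  | empty => simpa using posSemidef_one' ι
  | insert k s hk ih =>
    have h1 := (h k (Finset.mem_insert_self _ _)).hadamard
      (ih fun l hl => h l (Finset.mem_insert_of_mem hl))
    have e : (Matrix.of fun i j => ∏ l ∈ insert k s, A l i j) =
        Matrix.hadamard (Matrix.of (A k)) (Matrix.of fun i j => ∏ l ∈ s, A l i j) := by
      ext i j
      simp [Finset.prod_insert hk]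
    rw [e]
    exact h1

theorem posSemidef_inversions {q : ℝ} (h1 : -1 ≤ q) (h2 : q ≤ 1) (n : ℕ) :
    (Matrix.of fun σ τ : Equiv.Perm (Fin n) => (q : ℂ) ^ inversions (τ * σ⁻¹)).PosSemidef := by
  have h := posSemidef_prod
    (Finset.univ.filter fun p : Fin n × Fin n => p.1 < p.2)
    (fun p (σ τ : Equiv.Perm (Fin n)) =>
      if decide (σ p.1 < σ p.2) = decide (τ p.1 < τ p.2) then (1 : ℂ) else q)
    (fun p _ => (posSemidef_bool h1 h2).submatrix
      (fun σ : Equiv.Perm (Fin n) => decide (σ p.1 < σ p.2)))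
  convert h using 1
  ext σ τ
  rw [Matrix.of_apply, Matrix.of_apply, inversions_mul_inv, Finset.prod_ite, Finset.prod_const_one,
    one_mul, Finset.prod_const, Finset.filter_filter]
  simp only [decide_eq_decide]

variable {H : Type*} [NormedAddCommGroup H] [InnerProductSpace ℂ H]

theorem posSemidef_words {q : ℝ} (h1 : -1 ≤ q) (h2 : q ≤ 1) {n : ℕ} (s : Finset (Fin n → H)) :
    (Matrix.of fun p r : s × Equiv.Perm (Fin n) =>
      (q : ℂ) ^ inversions (r.2 * p.2⁻¹) *
        ∏ i, inner ℂ (p.1.1 (p.2 i)) (r.1.1 (r.2 i))).PosSemidef := by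
  have hA := (posSemidef_inversions h1 h2 n).submatrix (fun p : s × Equiv.Perm (Fin n) => p.2)
  have hB := posSemidef_prod Finset.univ
    (fun i (p r : s × Equiv.Perm (Fin n)) => inner ℂ (p.1.1 (p.2 i)) (r.1.1 (r.2 i)))
    (fun i _ => Matrix.posSemidef_gram (𝕜 := ℂ)
      (fun p : s × Equiv.Perm (Fin n) => p.1.1 (p.2 i)))
  exact hA.hadamard hB

theorem qForm_tprod_symm (q : ℝ) {n : ℕ} (f g : Fin n → H) :
    (∑ σ : Equiv.Perm (Fin n), ∑ τ : Equiv.Perm (Fin n),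
      (q : ℂ) ^ inversions (τ * σ⁻¹) * ∏ i, inner ℂ (f (σ i)) (g (τ i))) =
    (n.factorial : ℂ) *
      qForm q (TensorAlgebra.tprod ℂ H n f) (TensorAlgebra.tprod ℂ H n g) := by
  have h : ∀ σ : Equiv.Perm (Fin n), (∑ τ : Equiv.Perm (Fin n),
      (q : ℂ) ^ inversions (τ * σ⁻¹) * ∏ i, inner ℂ (f (σ i)) (g (τ i))) =
      qForm q (TensorAlgebra.tprod ℂ H n f) (TensorAlgebra.tprod ℂ H n g) := by
    intro σ
    rw [qForm_tprod]
    refine Fintype.sum_equiv (Equiv.mulRight σ⁻¹) _ _ fun τ => ?_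
    rw [Equiv.coe_mulRight, ← Equiv.prod_comp σ (fun i => inner ℂ (f i) (g ((τ * σ⁻¹) i)))]
    simp
  simp [h, Fintype.card_perm]

theorem qForm_self_nonneg_of_length {q : ℝ} (h1 : -1 ≤ q) (h2 : q ≤ 1) {n : ℕ}
    (s : Finset (Fin n → H)) (c : (Fin n → H) → ℂ) :
    0 ≤ qForm q (∑ f ∈ s, c f • TensorAlgebra.tprod ℂ H n f)
      (∑ f ∈ s, c f • TensorAlgebra.tprod ℂ H n f) := by
  classical
  have h := (posSemidef_words h1 h2 s).dotProduct_mulVec_nonneg (fun p => c p.1.1)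
  have key : (star fun p : s × Equiv.Perm (Fin n) => c p.1.1) ⬝ᵥ
      ((Matrix.of fun p r : s × Equiv.Perm (Fin n) =>
      (q : ℂ) ^ inversions (r.2 * p.2⁻¹) *
        ∏ i, inner ℂ (p.1.1 (p.2 i)) (r.1.1 (r.2 i))) *ᵥ fun p => c p.1.1) =
      (n.factorial : ℂ) * qForm q (∑ f ∈ s, c f • TensorAlgebra.tprod ℂ H n f)
      (∑ f ∈ s, c f • TensorAlgebra.tprod ℂ H n f) := by
    simp only [dotProduct, mulVec, Fintype.sum_prod_type, Matrix.of_apply,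
      Pi.star_apply]
    rw [qForm_sum_left]
    simp only [qForm_sum_right, qForm_smul_left, qForm_smul_right]
    have hs : ∀ F : (Fin n → H) → ℂ, ∑ f : s, F f.1 = ∑ f ∈ s, F f :=
      fun F => Finset.sum_coe_sort s F
    rw [hs fun f => ∑ σ : Equiv.Perm (Fin n), star (c f) *
      ∑ g : s, ∑ τ : Equiv.Perm (Fin n), (q : ℂ) ^ inversions (τ * σ⁻¹) *
        (∏ i, inner ℂ (f (σ i)) (g.1 (τ i))) * c g.1, Finset.mul_sum]
    refine Finset.sum_congr rfl fun f _ => ?_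
    rw [← Finset.mul_sum, Finset.sum_comm, hs fun g =>
      ∑ σ : Equiv.Perm (Fin n), ∑ τ : Equiv.Perm (Fin n), (q : ℂ) ^ inversions (τ * σ⁻¹) *
        (∏ i, inner ℂ (f (σ i)) (g (τ i))) * c g, Finset.mul_sum, Finset.mul_sum]
    refine Finset.sum_congr rfl fun g _ => ?_
    simp_rw [← Finset.sum_mul]
    rw [qForm_tprod_symm]
    simp only [RCLike.star_def]
    ring
  rw [key] at h
  have hn : (0 : ℂ) < n.factorial := by exact_mod_cast n.factorial_pos
  exact le_of_mul_le_mul_left (by rwa [mul_zero]) hn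

theorem span_tprod (x : TensorAlgebra ℂ H) :
    x ∈ Submodule.span ℂ (Set.range fun w : Σ n, Fin n → H => TensorAlgebra.tprod ℂ H w.1 w.2) := by
  induction x using leftInduction with
  | h1 => exact Submodule.subset_span ⟨⟨0, Fin.elim0⟩, tprod_zero _⟩
  | hsmul c x hx => exact Submodule.smul_mem _ _ hx
  | hadd x y hx hy => exact Submodule.add_mem _ hx hy
  | hmul v x hx =>
    induction hx using Submodule.span_induction with
    | mem x hx =>
      obtain ⟨⟨n, f⟩, rfl⟩ := hx
      exact Submodule.subset_span ⟨⟨n + 1, Fin.cons v f⟩, by simp⟩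
    | zero => simp
    | add x y _ _ hx hy => rw [mul_add]; exact Submodule.add_mem _ hx hy
    | smul c x _ hx => rw [mul_smul_comm]; exact Submodule.smul_mem _ _ hx

/-- The `q`-deformed form is positive semidefinite for `-1 ≤ q ≤ 1`. -/
theorem qForm_self_nonneg {q : ℝ} (h1 : -1 ≤ q) (h2 : q ≤ 1) (x : TensorAlgebra ℂ H) :
    0 ≤ qForm q x x := by
  classical
  obtain ⟨c, rfl⟩ := Finsupp.mem_span_range_iff_exists_finsupp.1 (span_tprod x)
  rw [Finsupp.sigma_sum c (fun w a => a • TensorAlgebra.tprod ℂ H w.1 w.2), qForm_sum_left]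
  refine Finset.sum_nonneg fun n hn => ?_
  rw [qForm_sum_right, Finset.sum_eq_single n]
  · exact qForm_self_nonneg_of_length h1 h2 _ _
  · intro m _ hm
    simp only [Finsupp.sum, qForm_sum_left, qForm_sum_right, qForm_smul_left, qForm_smul_right,
      qForm_tprod_of_ne q hm.symm, mul_zero, Finset.sum_const_zero]
  · exact fun h => absurd hn h

end Positivity

section Bound

variable (q : Set.Ioo (-1 : ℝ) 1)

/-- The bound for the norms of the creators and annihilators. -/
def fockBound {H : Type*} [NormedAddCommGroup H] (f : H) : ℝ := ‖f‖ / √(1 - |(q : ℝ)|)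

theorem one_sub_abs_pos : 0 < 1 - |(q : ℝ)| := by
  have := abs_lt.2 ⟨q.2.1, q.2.2⟩
  linarith

theorem fockBound_nonneg {H : Type*} [NormedAddCommGroup H] (f : H) : 0 ≤ fockBound q f := by unfold fockBound; positivity

theorem fockBound_sq {H : Type*} [NormedAddCommGroup H] (f : H) :
    ‖f‖ ^ 2 + |(q : ℝ)| * fockBound q f ^ 2 = fockBound q f ^ 2 := by
  have h := one_sub_abs_pos q
  rw [fockBound, div_pow, Real.sq_sqrt h.le]
  field_simp
  ring

end Bound

section Fock

open UniformSpace

variable (q : Set.Ioo (-1 : ℝ) 1) (H : Type*) [NormedAddCommGroup H] [InnerProductSpace ℂ H]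

/-- The algebraic Fock space: the tensor algebra (the linear span of the vacuum `1` and of the
simple tensors), to be equipped with the `q`-deformed inner product. -/
def FockPre (_q : Set.Ioo (-1 : ℝ) 1) (H : Type*) [NormedAddCommGroup H]
    [InnerProductSpace ℂ H] : Type _ := TensorAlgebra ℂ H

instance : AddCommGroup (FockPre q H) := inferInstanceAs (AddCommGroup (TensorAlgebra ℂ H))
instance : Module ℂ (FockPre q H) := inferInstanceAs (Module ℂ (TensorAlgebra ℂ H))

/-- The `q`-deformed inner product as a pre-inner product. -/
@[reducible] def fockCore : PreInnerProductSpace.Core ℂ (FockPre q H) where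
  inner x y := qForm (H := H) (q : ℝ) x y
  conj_inner_symm x y := qForm_conj (H := H) (q : ℝ) x y
  re_inner_nonneg x :=
    (Complex.le_def.1 (qForm_self_nonneg (H := H) q.2.1.le q.2.2.le x)).1
  add_left x y z := qForm_add_left (H := H) (q : ℝ) x y z
  smul_left x y r := qForm_smul_left (H := H) (q : ℝ) r x y

instance : SeminormedAddCommGroup (FockPre q H) :=
  @InnerProductSpace.Core.toSeminormedAddCommGroup ℂ _ _ _ _ (fockCore q H)

instance : InnerProductSpace ℂ (FockPre q H) := InnerProductSpace.ofCore (fockCore q H)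

/-- The `q`-deformed Fock space `Γ_q(H)`: the Hausdorff completion of the algebraic Fock space for
the `q`-deformed inner product. -/
def FockSpace : Type _ := Completion (FockPre q H)

instance : NormedAddCommGroup (FockSpace q H) :=
  inferInstanceAs (NormedAddCommGroup (Completion (FockPre q H)))
instance : InnerProductSpace ℂ (FockSpace q H) :=
  inferInstanceAs (InnerProductSpace ℂ (Completion (FockPre q H)))
instance : CompleteSpace (FockSpace q H) :=
  inferInstanceAs (CompleteSpace (Completion (FockPre q H)))

variable {H}

theorem inner_fockPre (x y : FockPre q H) : inner ℂ x y = qForm (H := H) (q : ℝ) x y := rfl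

/-- The canonical map of the algebraic Fock space into its completion. -/
def emb : FockPre q H →ₗᵢ[ℂ] FockSpace q H := Completion.toComplₗᵢ

theorem fockInduction {P : FockSpace q H → Prop} (hP : IsClosed {x | P x})
    (h : ∀ x : FockPre q H, P (emb q x)) (x : FockSpace q H) : P x :=
  Completion.induction_on (α := FockPre q H) x hP h

variable (H) in
/-- The vacuum vector `Ω`, the unit of the tensor algebra, in the algebraic Fock space. -/
def preVacuum : FockPre q H := (1 : TensorAlgebra ℂ H)

variable (H) in
/-- The vacuum vector `Ω` of the Fock space. -/
def vacuum : FockSpace q H := emb q (preVacuum q H)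

/-- The continuous extension to the Fock space of a bounded operator of the algebraic one. -/
def extend (T : FockPre q H →L[ℂ] FockPre q H) : FockSpace q H →L[ℂ] FockSpace q H :=
  ContinuousLinearMap.completion T

@[simp] theorem extend_emb (T : FockPre q H →L[ℂ] FockPre q H) (x : FockPre q H) :
    extend q T (emb q x) = emb q (T x) :=
  ContinuousLinearMap.completion_apply_coe T x

/-- Left multiplication by the letter `f` on the algebraic Fock space. -/
def preCreator (f : H) : FockPre q H →ₗ[ℂ] FockPre q H :=
  LinearMap.mulLeft ℂ (TensorAlgebra.ι ℂ f)

/-- The annihilator on the algebraic Fock space. -/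
def preAnnihilator (f : H) : FockPre q H →ₗ[ℂ] FockPre q H := annih (H := H) (q : ℝ) f

theorem inner_preCreator_left (f : H) (x y : FockPre q H) :
    inner ℂ (preCreator q f x) y = inner ℂ x (preAnnihilator q f y) :=
  qForm_ι_mul_left (H := H) (q : ℝ) f x y

theorem inner_preCreator_right (f : H) (x y : FockPre q H) :
    inner ℂ x (preCreator q f y) = inner ℂ (preAnnihilator q f x) y :=
  qForm_ι_mul_right (H := H) (q : ℝ) f x y

/-- The `q`-commutation relation on the algebraic Fock space. -/
theorem preAnnihilator_preCreator (f g : H) (x : FockPre q H) :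
    preAnnihilator q f (preCreator q g x) =
      inner ℂ f g • x + ((q : ℝ) : ℂ) • preCreator q g (preAnnihilator q f x) :=
  annih_ι_mul (H := H) (q : ℝ) f g x

theorem preAnnihilator_nilpotent (f : H) (x : FockPre q H) :
    ∃ n : ℕ, (preAnnihilator q f ^ n) x = 0 := by
  have mono : ∀ (y : FockPre q H) (n m : ℕ), n ≤ m → (preAnnihilator q f ^ n) y = 0 →
      (preAnnihilator q f ^ m) y = 0 := by
    intro y n m h hy
    obtain ⟨k, rfl⟩ := Nat.exists_eq_add_of_le h
    rw [add_comm, pow_add, Module.End.mul_apply, hy, map_zero]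
  have step : ∀ (v : H) (n : ℕ) (y : FockPre q H), (preAnnihilator q f ^ n) y = 0 →
      (preAnnihilator q f ^ (n + 1)) (preCreator q v y) = 0 := by
    intro v n
    induction n with
    | zero => intro y hy; have hy : y = 0 := hy; simp [hy]
    | succ n ih =>
      intro y hy
      rw [pow_succ, Module.End.mul_apply, preAnnihilator_preCreator, map_add, map_smul, map_smul,
        hy, ih _ (by rwa [pow_succ, Module.End.mul_apply] at hy), smul_zero, smul_zero, add_zero]
  refine leftInduction (H := H) (P := fun x => ∃ n : ℕ, (preAnnihilator q f ^ n) x = 0)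
    ?_ ?_ ?_ ?_ x
  · exact ⟨1, by rw [pow_one]; exact annih_one (H := H) (q : ℝ) f⟩
  · rintro c y ⟨n, hn⟩
    exact ⟨n, (map_smul (preAnnihilator q f ^ n) c y).trans
      ((congrArg (fun z : FockPre q H => c • z) hn).trans (smul_zero c))⟩
  · rintro y z ⟨n, hn⟩ ⟨m, hm⟩
    refine ⟨max n m, (map_add (preAnnihilator q f ^ (max n m)) y z).trans ?_⟩
    exact (congrArg₂ (fun a b : FockPre q H => a + b) (mono y n _ (le_max_left _ _) hn)
      (mono z m _ (le_max_right _ _) hm)).trans (add_zero _)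
  · rintro v y ⟨n, hn⟩
    exact ⟨n + 1, step v n y hn⟩

theorem norm_preCreator_sq (f : H) (x : FockPre q H) :
    ‖preCreator q f x‖ ^ 2 = ‖f‖ ^ 2 * ‖x‖ ^ 2 + q * ‖preAnnihilator q f x‖ ^ 2 := by
  have h : inner ℂ (preCreator q f x) (preCreator q f x) =
      inner ℂ f f * inner ℂ x x +
        ((q : ℝ) : ℂ) * inner ℂ (preAnnihilator q f x) (preAnnihilator q f x) := by
    rw [inner_preCreator_left, preAnnihilator_preCreator, inner_add_right, inner_smul_right,
      inner_smul_right, inner_preCreator_right]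
  simp only [inner_self_eq_norm_sq_to_K, Complex.coe_algebraMap] at h
  exact_mod_cast h

theorem norm_preAnnihilator_le_of (f : H) (x : FockPre q H)
    (h : ‖preCreator q f (preAnnihilator q f x)‖ ≤ fockBound q f * ‖preAnnihilator q f x‖) :
    ‖preAnnihilator q f x‖ ≤ fockBound q f * ‖x‖ := by
  rcases (norm_nonneg (preAnnihilator q f x)).eq_or_lt with h0 | h0
  · rw [← h0]; exact mul_nonneg (fockBound_nonneg q f) (norm_nonneg _)
  · have h1 : ‖preAnnihilator q f x‖ * ‖preAnnihilator q f x‖ ≤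
        ‖preAnnihilator q f x‖ * (fockBound q f * ‖x‖) := by
      have h2 := norm_inner_le_norm (𝕜 := ℂ) x (preCreator q f (preAnnihilator q f x))
      rw [inner_preCreator_right, inner_self_eq_norm_sq_to_K] at h2
      have h3 : ‖preAnnihilator q f x‖ ^ 2 ≤ ‖x‖ * ‖preCreator q f (preAnnihilator q f x)‖ := by
        simpa using h2
      calc _ = ‖preAnnihilator q f x‖ ^ 2 := by ring
        _ ≤ _ := h3
        _ ≤ ‖x‖ * (fockBound q f * ‖preAnnihilator q f x‖) := by gcongr
        _ = _ := by ring
    exact le_of_mul_le_mul_left h1 h0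

theorem norm_preCreator_le (f : H) (x : FockPre q H) :
    ‖preCreator q f x‖ ≤ fockBound q f * ‖x‖ := by
  obtain ⟨n, hn⟩ := preAnnihilator_nilpotent q f x
  induction n generalizing x with
  | zero =>
    have hx : x = 0 := hn
    simp [hx]
  | succ n ih =>
    have h1 := norm_preAnnihilator_le_of q f x
      (ih _ (by rwa [pow_succ, Module.End.mul_apply] at hn))
    refine (sq_le_sq₀ (norm_nonneg _) (mul_nonneg (fockBound_nonneg q f) (norm_nonneg _))).1 ?_
    have h2 : (q : ℝ) * ‖preAnnihilator q f x‖ ^ 2 ≤ |(q : ℝ)| * (fockBound q f * ‖x‖) ^ 2 := by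
      calc _ ≤ |(q : ℝ)| * ‖preAnnihilator q f x‖ ^ 2 := by gcongr; exact le_abs_self _
        _ ≤ _ := by gcongr
    calc _ = ‖f‖ ^ 2 * ‖x‖ ^ 2 + q * ‖preAnnihilator q f x‖ ^ 2 := norm_preCreator_sq q f x
      _ ≤ ‖f‖ ^ 2 * ‖x‖ ^ 2 + |(q : ℝ)| * (fockBound q f * ‖x‖) ^ 2 := by gcongr
      _ = (‖f‖ ^ 2 + |(q : ℝ)| * fockBound q f ^ 2) * ‖x‖ ^ 2 := by ring
      _ = (fockBound q f * ‖x‖) ^ 2 := by rw [fockBound_sq]; ring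

/-- The creator `a_q†(f)` on the `q`-deformed Fock space. -/
def creator (f : H) : FockSpace q H →L[ℂ] FockSpace q H :=
  extend q ((preCreator q f).mkContinuous (fockBound q f) (norm_preCreator_le q f))

/-- The annihilator `a_q(f)` on the `q`-deformed Fock space. -/
def annihilator (f : H) : FockSpace q H →L[ℂ] FockSpace q H :=
  extend q ((preAnnihilator q f).mkContinuous (fockBound q f) fun x =>
    norm_preAnnihilator_le_of q f x (norm_preCreator_le q f _))

/-- The self-adjoint part `s_q(f) = a_q(f) + a_q†(f)` of the annihilator. -/
def fieldOp (f : H) : FockSpace q H →L[ℂ] FockSpace q H := annihilator q f + creator q f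

@[simp] theorem creator_emb (f : H) (x : FockPre q H) :
    creator q f (emb q x) = emb q (preCreator q f x) := extend_emb q _ x

@[simp] theorem annihilator_emb (f : H) (x : FockPre q H) :
    annihilator q f (emb q x) = emb q (preAnnihilator q f x) := extend_emb q _ x

/-- The creator and the annihilator are mutually adjoint. -/
theorem adjoint_annihilator (f : H) :
    ContinuousLinearMap.adjoint (annihilator q f) = creator q f := by
  symm
  rw [ContinuousLinearMap.eq_adjoint_iff]
  intro x y
  induction x using fockInduction with
  | hP => exact isClosed_eq (by fun_prop) (by fun_prop)
  | h x =>
    induction y using fockInduction with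
    | hP => exact isClosed_eq (by fun_prop) (by fun_prop)
    | h y =>
      rw [creator_emb, annihilator_emb, LinearIsometry.inner_map_map,
        LinearIsometry.inner_map_map, inner_preCreator_left]

end Fock

section SecondQuantization

open UniformSpace

variable (q : Set.Ioo (-1 : ℝ) 1) {H : Type*} [NormedAddCommGroup H] [InnerProductSpace ℂ H]

/-- The map `f₁ ⊗ ⋯ ⊗ fₙ ↦ U f₁ ⊗ ⋯ ⊗ U fₙ` on the tensor algebra. -/
def tensorMap (U : H ≃ₗᵢ[ℂ] H) : TensorAlgebra ℂ H →ₐ[ℂ] TensorAlgebra ℂ H :=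
  TensorAlgebra.lift ℂ (TensorAlgebra.ι ℂ ∘ₗ U.toLinearEquiv.toLinearMap)

@[simp] theorem tensorMap_ι (U : H ≃ₗᵢ[ℂ] H) (v : H) :
    tensorMap U (TensorAlgebra.ι ℂ v) = TensorAlgebra.ι ℂ (U v) := by
  simp [tensorMap]

theorem tensorMap_annih (U : H ≃ₗᵢ[ℂ] H) (r : ℝ) (f : H) (x : TensorAlgebra ℂ H) :
    tensorMap U (annih r f x) = annih r (U f) (tensorMap U x) := by
  induction x using leftInduction with
  | h1 => simp
  | hsmul c x hx => simp only [map_smul, hx]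
  | hadd x y hx hy => simp only [map_add, hx, hy]
  | hmul v x hx =>
    rw [annih_ι_mul, map_mul, tensorMap_ι, annih_ι_mul, map_add, map_smul, map_smul, map_mul,
      tensorMap_ι, hx, LinearIsometryEquiv.inner_map_map]

theorem qForm_tensorMap (U : H ≃ₗᵢ[ℂ] H) (r : ℝ) (x y : TensorAlgebra ℂ H) :
    qForm r (tensorMap U x) (tensorMap U y) = qForm r x y := by
  induction y using leftInduction generalizing x with
  | h1 =>
    rw [map_one, qForm_one_right, qForm_one_right]
    induction x using leftInduction with
    | h1 => simp
    | hsmul c x hx => simp only [map_smul, map_smulₛₗ, hx]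
    | hadd x y hx hy => simp only [map_add, hx, hy]
    | hmul v x hx => simp
  | hsmul c y hy => simp only [map_smul, qForm_smul_right, hy]
  | hadd y z hy hz => simp only [map_add, qForm_add_right, hy, hz]
  | hmul w y hy =>
    rw [map_mul, tensorMap_ι, qForm_ι_mul_right, qForm_ι_mul_right, ← tensorMap_annih, hy]

theorem tensorMap_symm_apply (U : H ≃ₗᵢ[ℂ] H) (x : TensorAlgebra ℂ H) :
    tensorMap U.symm (tensorMap U x) = x := by
  induction x using leftInduction with
  | h1 => simp
  | hsmul c x hx => simp only [map_smul, hx]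
  | hadd x y hx hy => simp only [map_add, hx, hy]
  | hmul v x hx => simp [hx]

/-- The second quantization of a unitary on the algebraic Fock space. -/
def preSecondQuant (U : H ≃ₗᵢ[ℂ] H) : FockPre q H →ₗᵢ[ℂ] FockPre q H :=
  LinearMap.isometryOfInner (E := FockPre q H) (E' := FockPre q H)
    (tensorMap U).toLinearMap (qForm_tensorMap U (q : ℝ))

/-- The second quantization on the Fock space as an isometry. -/
def secondQuantMap (U : H ≃ₗᵢ[ℂ] H) : FockSpace q H →L[ℂ] FockSpace q H :=
  extend q (preSecondQuant q U).toContinuousLinearMap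

@[simp] theorem secondQuantMap_emb (U : H ≃ₗᵢ[ℂ] H) (x : FockPre q H) :
    secondQuantMap q U (emb q x) = emb q (preSecondQuant q U x) := extend_emb q _ x

theorem secondQuantMap_symm_apply (U : H ≃ₗᵢ[ℂ] H) (x : FockSpace q H) :
    secondQuantMap q U.symm (secondQuantMap q U x) = x := by
  induction x using fockInduction with
  | hP => exact isClosed_eq (by fun_prop) (by fun_prop)
  | h x =>
    rw [secondQuantMap_emb, secondQuantMap_emb]
    exact congrArg _ (tensorMap_symm_apply U x)

/-- The second quantization `Γ_q(U)` of a unitary `U`, the unitary of the Fock space with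
`f₁ ⊗ ⋯ ⊗ fₙ ↦ U f₁ ⊗ ⋯ ⊗ U fₙ` and `Ω ↦ Ω`. -/
def secondQuant (U : H ≃ₗᵢ[ℂ] H) : FockSpace q H ≃ₗᵢ[ℂ] FockSpace q H where
  toLinearEquiv := LinearEquiv.ofLinearMap (secondQuantMap q U).toLinearMap
    (secondQuantMap q U.symm).toLinearMap
    (LinearMap.ext fun x => secondQuantMap_symm_apply q U.symm x)
    (LinearMap.ext fun x => secondQuantMap_symm_apply q U x)
  norm_map' x := by
    change ‖secondQuantMap q U x‖ = ‖x‖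
    induction x using fockInduction with
    | hP => exact isClosed_eq (by fun_prop) (by fun_prop)
    | h x =>
      rw [secondQuantMap_emb, LinearIsometry.norm_map, LinearIsometry.norm_map,
        LinearIsometry.norm_map]

theorem secondQuant_apply (U : H ≃ₗᵢ[ℂ] H) (x : FockSpace q H) :
    secondQuant q U x = secondQuantMap q U x := rfl

theorem secondQuant_symm (U : H ≃ₗᵢ[ℂ] H) : (secondQuant q U).symm = secondQuant q U.symm := rfl

/-- Conjugation by `Γ_q(U)` maps `a_q(f)` to `a_q(U f)`. -/
theorem conj_annihilator (U : H ≃ₗᵢ[ℂ] H) (f : H) :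
    (secondQuant q U).conjStarAlgEquiv (annihilator q f) = annihilator q (U f) := by
  refine ContinuousLinearMap.ext fun x => ?_
  rw [LinearIsometryEquiv.conjStarAlgEquiv_apply_apply, secondQuant_symm, secondQuant_apply,
    secondQuant_apply]
  induction x using fockInduction with
  | hP => exact isClosed_eq (by fun_prop) (by fun_prop)
  | h x =>
    rw [secondQuantMap_emb, annihilator_emb, secondQuantMap_emb, annihilator_emb]
    refine congrArg _ ?_
    change tensorMap U (annih (q : ℝ) f (tensorMap U.symm x)) = annih (q : ℝ) (U f) x
    rw [tensorMap_annih]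
    exact congrArg _ (tensorMap_symm_apply U.symm x)

/-- Conjugation by `Γ_q(U)` maps `a_q†(f)` to `a_q†(U f)`. -/
theorem conj_creator (U : H ≃ₗᵢ[ℂ] H) (f : H) :
    (secondQuant q U).conjStarAlgEquiv (creator q f) = creator q (U f) := by
  rw [← adjoint_annihilator, ← adjoint_annihilator, ← conj_annihilator,
    ← ContinuousLinearMap.star_eq_adjoint, ← ContinuousLinearMap.star_eq_adjoint, map_star]

/-- Conjugation by `Γ_q(U)` maps `s_q(f)` to `s_q(U f)`. -/
theorem conj_fieldOp (U : H ≃ₗᵢ[ℂ] H) (f : H) :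
    (secondQuant q U).conjStarAlgEquiv (fieldOp q f) = fieldOp q (U f) := by
  rw [fieldOp, map_add, conj_annihilator, conj_creator, fieldOp]

end SecondQuantization

section Algebras

open scoped ComplexOrder

variable (q : Set.Ioo (-1 : ℝ) 1)

/-- The Hilbert space `ℓ²(ℤ)`. -/
abbrev L2Z : Type := lp (fun _ : ℤ => ℂ) 2

/-- The canonical basis vector `e_i` of `ℓ²(ℤ)`. -/
def basisVec (i : ℤ) : L2Z := lp.single 2 i 1

/-- The group `ℙ_J` of the permutations of `J` moving only finitely many points. -/
def finPerm (J : Type*) : Subgroup (Equiv.Perm J) where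
  carrier := {g | {j | g j ≠ j}.Finite}
  one_mem' := by simp
  mul_mem' := by
    intro g h hg hh
    refine (Set.Finite.union hg hh).subset fun j hj => ?_
    by_contra hcon
    simp only [Set.mem_union, Set.mem_ofPred_eq, not_or, not_not] at hcon
    exact hj (by rw [Equiv.Perm.mul_apply, hcon.2, hcon.1])
  inv_mem' := by
    intro g hg
    refine Set.Finite.subset hg fun j hj hcon => hj ?_
    rw [Equiv.Perm.inv_eq_iff_eq]
    exact hcon.symm

theorem memℓp_comp (g : Equiv.Perm ℤ) (x : L2Z) : Memℓp (fun i => x (g i)) 2 := by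
  have h := lp.memℓp x
  rw [memℓp_gen_iff (by norm_num)] at h ⊢
  exact h.comp_injective g.injective

/-- The unitary of `ℓ²(ℤ)` permuting the coordinates, `(U_g x) i = x (g⁻¹ i)`. -/
def permUnitary (g : Equiv.Perm ℤ) : L2Z ≃ₗᵢ[ℂ] L2Z where
  toFun x := ⟨fun i => x (g.symm i), memℓp_comp g.symm x⟩
  invFun x := ⟨fun i => x (g i), memℓp_comp g x⟩
  left_inv x := by ext i; simp
  right_inv x := by ext i; simp
  map_add' x y := rfl
  map_smul' c x := rfl
  norm_map' x := by
    rw [lp.norm_eq_tsum_rpow (by norm_num), lp.norm_eq_tsum_rpow (by norm_num)]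
    congr 1
    exact g.symm.tsum_eq fun i => ‖x i‖ ^ (2 : ENNReal).toReal

theorem permUnitary_basisVec (g : Equiv.Perm ℤ) (i : ℤ) :
    permUnitary g (basisVec i) = basisVec (g i) := by
  ext j
  change (Pi.single i 1 : ℤ → ℂ) (g.symm j) = (Pi.single (g i) 1 : ℤ → ℂ) j
  simp [Pi.single_apply, Equiv.symm_apply_eq]

/-- The bounded operators on `Γ_q(ℓ²(ℤ))`. -/
abbrev FockOp : Type := FockSpace q L2Z →L[ℂ] FockSpace q L2Z

/-- The automorphism of the bounded operators on `Γ_q(ℓ²(ℤ))` implemented by `Γ_q(U_g)`. -/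
def permAut (g : Equiv.Perm ℤ) : FockOp q ≃⋆ₐ[ℂ] FockOp q :=
  (secondQuant q (permUnitary g)).conjStarAlgEquiv

/-- The action of the permutations on the annihilators is `a_i ↦ a_{g i}`. -/
theorem permAut_annihilator_basisVec (g : Equiv.Perm ℤ) (i : ℤ) :
    permAut q g (annihilator q (basisVec i)) = annihilator q (basisVec (g i)) := by
  rw [permAut, conj_annihilator, permUnitary_basisVec]

/-- The concrete unital C*-algebra of operators on `Γ_q(ℓ²(ℤ))` generated by a set. -/
def generated (S : Set (FockOp q)) : StarSubalgebra ℂ (FockOp q) :=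
  (StarAlgebra.adjoin ℂ S).topologicalClosure

/-- The operators of a concrete C*-algebra `A` are mapped to `A` by all permutations. -/
def PermStable (A : StarSubalgebra ℂ (FockOp q)) : Prop :=
  ∀ g : Equiv.Perm ℤ, ∀ T ∈ A, permAut q g T ∈ A

theorem continuous_permAut (g : Equiv.Perm ℤ) : Continuous (permAut q g) := by
  change Continuous fun T : FockOp q => permAut q g T
  simp only [permAut, LinearIsometryEquiv.conjStarAlgEquiv_apply]
  fun_prop

/-- `permAut` as a homomorphism. -/
def permHom (g : Equiv.Perm ℤ) : FockOp q →⋆ₐ[ℂ] FockOp q where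
  toAlgHom := (permAut q g).toAlgEquiv.toAlgHom
  map_star' := (permAut q g).map_star'

theorem permStable_generated {S : Set (FockOp q)}
    (hS : ∀ g : Equiv.Perm ℤ, ∀ T ∈ S, permAut q g T ∈ S) : PermStable q (generated q S) := by
  intro g
  have h1 : StarAlgebra.adjoin ℂ S ≤
      (generated q S).comap (permHom q g) := by
    refine StarAlgebra.adjoin_le fun T hT => ?_
    exact StarSubalgebra.le_topologicalClosure _ (StarAlgebra.subset_adjoin ℂ S (hS g T hT))
  have h2 : IsClosed (((generated q S).comap (permHom q g) :
      StarSubalgebra ℂ (FockOp q)) : Set (FockOp q)) :=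
    (StarSubalgebra.isClosed_topologicalClosure _).preimage (continuous_permAut q g)
  exact StarSubalgebra.topologicalClosure_minimal h1 h2

theorem permAut_inv_apply (g : Equiv.Perm ℤ) (T : FockOp q) :
    permAut q g⁻¹ (permAut q g T) = T :=
  (permAut q g).symm_apply_apply T

/-- The restriction `α_g` of the automorphism of `g` to a concrete C*-algebra. -/
def restrictAut {A : StarSubalgebra ℂ (FockOp q)} (hA : PermStable q A) (g : Equiv.Perm ℤ) :
    A ≃⋆ₐ[ℂ] A where
  toFun T := ⟨permAut q g T, hA g T T.2⟩
  invFun T := ⟨permAut q g⁻¹ T, hA g⁻¹ T T.2⟩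
  left_inv T := Subtype.ext (permAut_inv_apply q g T)
  right_inv T := Subtype.ext (by simpa using permAut_inv_apply q g⁻¹ T)
  map_mul' S T := Subtype.ext (map_mul (permAut q g) (S : FockOp q) T)
  map_add' S T := Subtype.ext (map_add (permAut q g) (S : FockOp q) T)
  map_star' T := Subtype.ext ((permAut q g).map_star' (T : FockOp q))
  map_smul' c T := Subtype.ext (map_smul (permAut q g) c (T : FockOp q))

/-- A state of a unital C*-algebra: a positive normalized (bounded) linear functional. -/
def IsState {A : StarSubalgebra ℂ (FockOp q)} (φ : A →L[ℂ] ℂ) : Prop :=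
  (∀ T : A, 0 ≤ φ (star T * T)) ∧ φ 1 = 1

/-- The set `S_{ℙ_ℤ}(A)` of the states invariant under all finite permutations of `ℤ`. -/
def symmetricStates {A : StarSubalgebra ℂ (FockOp q)} (hA : PermStable q A) : Set (A →L[ℂ] ℂ) :=
  {φ | IsState q φ ∧ ∀ g ∈ finPerm ℤ, ∀ T : A, φ (restrictAut q hA g T) = φ T}

/-- The Fock vacuum expectation `T ↦ ⟨Ω, T Ω⟩` on a concrete C*-algebra. -/
def vacuumState (A : StarSubalgebra ℂ (FockOp q)) : A →L[ℂ] ℂ :=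
  (innerSL ℂ (vacuum q L2Z)).comp
    ((ContinuousLinearMap.apply ℂ (FockSpace q L2Z) (vacuum q L2Z)).comp
      A.toSubalgebra.toSubmodule.subtypeL)

/-- The unital C*-algebra generated by the annihilators `a_q(f)`, `f ∈ ℓ²(ℤ)`. -/
def algR : StarSubalgebra ℂ (FockOp q) := generated q (Set.range fun f : L2Z => annihilator q f)

/-- The unital C*-algebra generated by the self-adjoint parts `s_q(f) = a_q(f) + a_q†(f)` of all
annihilators, `f ∈ ℓ²(ℤ)`. -/
def algG : StarSubalgebra ℂ (FockOp q) := generated q (Set.range fun f : L2Z => fieldOp q f)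

/-- The unital C*-algebra generated by the self-adjoint parts `s_i = a_i + a_i†`, `i ∈ ℤ`. -/
def algGReal : StarSubalgebra ℂ (FockOp q) :=
  generated q (Set.range fun i : ℤ => fieldOp q (basisVec i))

theorem permStable_algR : PermStable q (algR q) := by
  refine permStable_generated q ?_
  rintro g _ ⟨f, rfl⟩
  exact ⟨permUnitary g f, (conj_annihilator q _ f).symm⟩

theorem permStable_algG : PermStable q (algG q) := by
  refine permStable_generated q ?_
  rintro g _ ⟨f, rfl⟩
  exact ⟨permUnitary g f, (conj_fieldOp q _ f).symm⟩

theorem permStable_algGReal : PermStable q (algGReal q) := by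
  refine permStable_generated q ?_
  rintro g _ ⟨i, rfl⟩
  refine ⟨g i, ?_⟩
  change fieldOp q (basisVec (g i)) = permAut q g (fieldOp q (basisVec i))
  rw [permAut, conj_fieldOp, permUnitary_basisVec]

end Algebras

end QFock

end

noncomputable section

namespace QFock

open scoped ComplexOrder
open Filter Topology

/-! ### Relations of creators and annihilators on the completed Fock space -/

section FockRelations

variable (q : Set.Ioo (-1 : ℝ) 1) {H : Type*} [NormedAddCommGroup H] [InnerProductSpace ℂ H]

/-! The theorem follows from a norm-convergent ergodic averaging: for every `T` in `algR q` there
are averages of `T` over finite permutations that converge in norm to `⟨Ω, T Ω⟩ • 1`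
(`mem_mixingSubmodule_of_mem_algR`). An invariant state takes the same value on `T` and on each
average, so by continuity and normalization this value is `⟨Ω, T Ω⟩`. The other two algebras lie in
`algR q`, and the averages of an element stay in its algebra, so the same argument covers them.

The convergence rests on two facts. The first is a row estimate: for orthonormal `e_1, …, e_n`, the
row of the creators `a†(e_k)` has norm at most `1 / √(1 - |q|)`, whatever `n` is
(`norm_sum_creator_sq_le`). Permutations carrying `i` to `n` different places turn `a†(e_i) T` into
operators `a†(e_{i_k}) T_k` with `‖T_k‖ ≤ ‖T‖`, whose mean therefore has norm `O(n^{-1/2})`. Nothing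
about `T` but its norm enters, so one creator on the left suffices to make the averages vanish;
taking adjoints, so does one annihilator on the right.

The second is Wick ordering: by the `q`-commutation relation, every *-polynomial in the annihilators
is a combination of `1` and of words that begin with a creator or end with an annihilator
(`isWick_of_mem_adjoin`). Such words have vacuum expectation zero, in accordance with their limit.
Averages and vacuum expectation are contractions, so the convergence passes to the norm closure
(`isClosed_mixingSubmodule`). -/

theorem inner_creator_left (f : H) (x y : FockSpace q H) :
    inner ℂ (creator q f x) y = inner ℂ x (annihilator q f y) := by
  rw [← adjoint_annihilator, ContinuousLinearMap.adjoint_inner_left]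

theorem inner_creator_right (f : H) (x y : FockSpace q H) :
    inner ℂ x (creator q f y) = inner ℂ (annihilator q f x) y := by
  rw [← adjoint_annihilator, ContinuousLinearMap.adjoint_inner_right]

/-- The `q`-commutation relation `a_q(f) a_q†(g) = ⟪f, g⟫ + q a_q†(g) a_q(f)`. -/
theorem annihilator_creator_apply (f g : H) (x : FockSpace q H) :
    annihilator q f (creator q g x) =
      inner ℂ f g • x + ((q : ℝ) : ℂ) • creator q g (annihilator q f x) := by
  induction x using fockInduction with
  | hP =>
    exact isClosed_eq (annihilator q f ∘L creator q g).continuous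
      (inner ℂ f g • ContinuousLinearMap.id ℂ (FockSpace q H) +
        ((q : ℝ) : ℂ) • (creator q g ∘L annihilator q f)).continuous
  | h x =>
    rw [creator_emb, annihilator_emb, annihilator_emb, creator_emb, preAnnihilator_preCreator,
      map_add, map_smul, map_smul]

theorem star_annihilator (f : H) : star (annihilator q f) = creator q f := by
  rw [ContinuousLinearMap.star_eq_adjoint, adjoint_annihilator]

theorem star_creator (f : H) : star (creator q f) = annihilator q f := by
  rw [← star_annihilator, star_star]

theorem creator_add (f g : H) : creator q (f + g) = creator q f + creator q g := by
  refine ContinuousLinearMap.ext fun x => ?_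
  induction x using fockInduction with
  | hP => exact isClosed_eq (by fun_prop) (by fun_prop)
  | h x =>
    rw [add_apply, creator_emb, creator_emb, creator_emb, ← map_add]
    refine congrArg _ ?_
    -- `FockPre` carries no product, so the identity is taken from the tensor algebra, by right
    -- multiplication with `x`.
    exact (congrArg (LinearMap.mulRight ℂ (A := TensorAlgebra ℂ H) x)
      (map_add (TensorAlgebra.ι ℂ) f g)).trans
      (add_mul (R := TensorAlgebra ℂ H) _ _ _)

theorem creator_smul (c : ℂ) (f : H) : creator q (c • f) = c • creator q f := by
  refine ContinuousLinearMap.ext fun x => ?_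
  induction x using fockInduction with
  | hP => exact isClosed_eq (creator q (c • f)).continuous (c • creator q f).continuous
  | h x =>
    rw [smul_apply, creator_emb, creator_emb, ← map_smul]
    refine congrArg _ ?_
    exact (congrArg (LinearMap.mulRight ℂ (A := TensorAlgebra ℂ H) x)
      (map_smul (TensorAlgebra.ι ℂ) c f)).trans
      (smul_mul_assoc (β := TensorAlgebra ℂ H) _ _ _)

theorem norm_creator_le (f : H) : ‖creator q f‖ ≤ fockBound q f := by
  refine ContinuousLinearMap.opNorm_le_bound _ (fockBound_nonneg q f) fun x => ?_
  induction x using fockInduction with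
  | hP => exact isClosed_le (by fun_prop) (by fun_prop)
  | h x =>
    rw [creator_emb, LinearIsometry.norm_map, LinearIsometry.norm_map]
    exact norm_preCreator_le q f x

variable (H) in
/-- The creator `f ↦ a_q†(f)` as a bounded linear map. -/
def creatorCLM : H →L[ℂ] FockSpace q H →L[ℂ] FockSpace q H :=
  LinearMap.mkContinuous
    { toFun := creator q
      map_add' := creator_add q
      map_smul' := creator_smul q } (1 / √(1 - |(q : ℝ)|)) fun f => by
    refine (norm_creator_le q f).trans_eq ?_
    rw [fockBound, div_mul_eq_mul_div, one_mul]

@[simp] theorem annihilator_vacuum (f : H) : annihilator q f (vacuum q H) = 0 := by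
  rw [vacuum, annihilator_emb]
  exact (congrArg (emb q) (annih_one (H := H) (q : ℝ) f)).trans (map_zero _)

variable (H) in
theorem inner_vacuum_vacuum : inner ℂ (vacuum q H) (vacuum q H) = 1 := by
  rw [vacuum, LinearIsometry.inner_map_map, inner_fockPre]
  exact (qForm_one_right (H := H) (q : ℝ) _).trans vacConj_one

theorem secondQuant_vacuum (U : H ≃ₗᵢ[ℂ] H) : secondQuant q U (vacuum q H) = vacuum q H := by
  rw [secondQuant_apply, vacuum, secondQuantMap_emb]
  exact congrArg (emb q) (map_one (tensorMap U))

end FockRelations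

/-! ### Norm of a row of creators -/

section RowEstimate

variable (q : Set.Ioo (-1 : ℝ) 1) {H : Type*} [NormedAddCommGroup H] [InnerProductSpace ℂ H]
  {ι : Type*} [Fintype ι] {e : ι → H}

/-- Commuting `a(e_k)` past `a†(e_l)` in the expanded square leaves a diagonal term, by
orthonormality, and `q` times a double sum of inner products. The latter is estimated so that the
indices no longer cross, which lets the bound be fed back into itself below. -/
theorem norm_sum_creator_sq_le_add (he : Orthonormal ℂ e) (x : ι → FockSpace q H) :
    ‖∑ k, creator q (e k) (x k)‖ ^ 2 ≤
      ∑ k, ‖x k‖ ^ 2 + |(q : ℝ)| * ∑ k, ∑ l, ‖annihilator q (e l) (x k)‖ ^ 2 := by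
  classical
  have h1 : inner ℂ (∑ k, creator q (e k) (x k)) (∑ k, creator q (e k) (x k)) =
      ∑ k, inner ℂ (x k) (x k) + ((q : ℝ) : ℂ) * ∑ k, ∑ l,
        inner ℂ (annihilator q (e l) (x k)) (annihilator q (e k) (x l)) := by
    rw [sum_inner, Finset.mul_sum, ← Finset.sum_add_distrib]
    refine Finset.sum_congr rfl fun k _ => ?_
    have h : ∀ l, inner ℂ (creator q (e k) (x k)) (creator q (e l) (x l)) =
        (if k = l then inner ℂ (x k) (x l) else 0) + ((q : ℝ) : ℂ) *
          inner ℂ (annihilator q (e l) (x k)) (annihilator q (e k) (x l)) := by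
      intro l
      rw [inner_creator_left, annihilator_creator_apply, inner_add_right, inner_smul_right,
        inner_smul_right, inner_creator_right, orthonormal_iff_ite.1 he, ite_mul, one_mul,
        zero_mul]
    rw [inner_sum]
    simp [h, Finset.sum_add_distrib, Finset.mul_sum]
  -- Cauchy–Schwarz and `2ab ≤ a² + b²`; exchanging `k` and `l` in one of the two halves makes them
  -- equal.
  have h2 : ‖∑ k, ∑ l, inner ℂ (annihilator q (e l) (x k)) (annihilator q (e k) (x l))‖ ≤
      ∑ k, ∑ l, ‖annihilator q (e l) (x k)‖ ^ 2 := by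
    have h3 : ∀ k l, ‖inner ℂ (annihilator q (e l) (x k)) (annihilator q (e k) (x l))‖ ≤
        ‖annihilator q (e l) (x k)‖ ^ 2 / 2 + ‖annihilator q (e k) (x l)‖ ^ 2 / 2 := by
      intro k l
      refine (norm_inner_le_norm (𝕜 := ℂ) _ _).trans ?_
      linarith [two_mul_le_add_sq ‖annihilator q (e l) (x k)‖ ‖annihilator q (e k) (x l)‖]
    calc _ ≤ ∑ k, ∑ l, (‖annihilator q (e l) (x k)‖ ^ 2 / 2 +
          ‖annihilator q (e k) (x l)‖ ^ 2 / 2) :=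
        norm_sum_le_of_le _ fun k _ => norm_sum_le_of_le _ fun l _ => h3 k l
      _ = _ := by
        simp only [Finset.sum_add_distrib]
        rw [Finset.sum_comm (f := fun k l => ‖annihilator q (e k) (x l)‖ ^ 2 / 2)]
        simp only [← Finset.sum_add_distrib, add_halves]
  have h4 : ‖∑ k, creator q (e k) (x k)‖ ^ 2 =
      ‖inner ℂ (∑ k, creator q (e k) (x k)) (∑ k, creator q (e k) (x k))‖ := by
    rw [inner_self_eq_norm_sq_to_K]; simp
  rw [h4, h1]
  refine (norm_add_le _ _).trans (add_le_add ?_ ?_)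
  · refine norm_sum_le_of_le _ fun k _ => ?_
    rw [inner_self_eq_norm_sq_to_K]; simp
  · rw [norm_mul, Complex.norm_real, Real.norm_eq_abs]
    gcongr

/-- The sum is the quadratic form of `∑ a†(e_k) a(e_k)` at `x`, so a norm bound for that operator
controls the column of annihilators. -/
theorem sum_norm_annihilator_sq (x : FockSpace q H) :
    ∑ k, ‖annihilator q (e k) x‖ ^ 2 =
      ‖inner ℂ x (∑ k, creator q (e k) (annihilator q (e k) x))‖ := by
  have h : inner ℂ x (∑ k, creator q (e k) (annihilator q (e k) x)) =
      ((∑ k, ‖annihilator q (e k) x‖ ^ 2 : ℝ) : ℂ) := by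
    simp only [inner_sum, inner_creator_right, inner_self_eq_norm_sq_to_K]
    simp
  rw [h, Complex.norm_real, Real.norm_of_nonneg (by positivity)]

/-- The number-like operator `∑ k, a_q†(e_k) a_q(e_k)` is bounded by `1 / (1 - |q|)`, for every
finite orthonormal family. -/
theorem norm_sum_creator_comp_annihilator_le (he : Orthonormal ℂ e) :
    ‖∑ k, creator q (e k) ∘L annihilator q (e k)‖ ≤ 1 / (1 - |(q : ℝ)|) := by
  set N := ∑ k, creator q (e k) ∘L annihilator q (e k) with hN
  have hNx : ∀ x, N x = ∑ k, creator q (e k) (annihilator q (e k) x) := fun x => by simp [hN]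
  have h1 : ∀ x, ∑ k, ‖annihilator q (e k) x‖ ^ 2 ≤ ‖N‖ * ‖x‖ ^ 2 := by
    intro x
    rw [sum_norm_annihilator_sq, ← hNx]
    calc _ ≤ ‖x‖ * ‖N x‖ := norm_inner_le_norm _ _
      _ ≤ ‖x‖ * (‖N‖ * ‖x‖) := by gcongr; exact N.le_opNorm x
      _ = _ := by ring
  -- A self-improving bound: `norm_sum_creator_sq_le_add` at `x_k = a(e_k) x`, with `h1` used for
  -- both sums, gives `‖N‖² ≤ (1 + |q| ‖N‖) ‖N‖`. As `‖N‖` is finite and `|q| < 1`, this can be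
  -- solved for `‖N‖`.
  have h2 : ‖N‖ ≤ √((1 + |(q : ℝ)| * ‖N‖) * ‖N‖) := by
    refine ContinuousLinearMap.opNorm_le_bound _ (Real.sqrt_nonneg _) fun x => ?_
    refine (sq_le_sq₀ (norm_nonneg _) (by positivity)).1 ?_
    rw [mul_pow, Real.sq_sqrt (by positivity)]
    calc _ ≤ ∑ k, ‖annihilator q (e k) x‖ ^ 2 + |(q : ℝ)| * ∑ k, ∑ l,
          ‖annihilator q (e l) (annihilator q (e k) x)‖ ^ 2 := by
          rw [hNx]; exact norm_sum_creator_sq_le_add q he _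
      _ ≤ ∑ k, ‖annihilator q (e k) x‖ ^ 2 + |(q : ℝ)| * ∑ k,
          ‖N‖ * ‖annihilator q (e k) x‖ ^ 2 := by gcongr; exact h1 _
      _ = (1 + |(q : ℝ)| * ‖N‖) * ∑ k, ‖annihilator q (e k) x‖ ^ 2 := by
          rw [← Finset.mul_sum]; ring
      _ ≤ (1 + |(q : ℝ)| * ‖N‖) * (‖N‖ * ‖x‖ ^ 2) := by gcongr; exact h1 x
      _ = _ := by ring
  have h3 := one_sub_abs_pos q
  rw [le_div_iff₀ h3]
  rcases (norm_nonneg N).eq_or_lt with h0 | h0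
  · rw [← h0]; simp
  · rw [Real.le_sqrt (norm_nonneg _) (by positivity), sq] at h2
    linarith [le_of_mul_le_mul_right h2 h0]

/-- The row of the creators of an orthonormal family is bounded by `1 / √(1 - |q|)`. -/
theorem norm_sum_creator_sq_le (he : Orthonormal ℂ e) (x : ι → FockSpace q H) :
    ‖∑ k, creator q (e k) (x k)‖ ^ 2 ≤ 1 / (1 - |(q : ℝ)|) * ∑ k, ‖x k‖ ^ 2 := by
  have h3 := one_sub_abs_pos q
  have h1 : ∀ x, ∑ k, ‖annihilator q (e k) x‖ ^ 2 ≤ 1 / (1 - |(q : ℝ)|) * ‖x‖ ^ 2 := by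
    intro x
    rw [sum_norm_annihilator_sq]
    have h : ∑ k, creator q (e k) (annihilator q (e k) x) =
        (∑ k, creator q (e k) ∘L annihilator q (e k)) x := by simp
    rw [h]
    calc _ ≤ ‖x‖ * ‖(∑ k, creator q (e k) ∘L annihilator q (e k)) x‖ := norm_inner_le_norm _ _
      _ ≤ ‖x‖ * (1 / (1 - |(q : ℝ)|) * ‖x‖) := by
        gcongr
        exact ContinuousLinearMap.le_of_opNorm_le _ (norm_sum_creator_comp_annihilator_le q he) x
      _ = _ := by ring
  calc _ ≤ ∑ k, ‖x k‖ ^ 2 + |(q : ℝ)| * ∑ k, ∑ l, ‖annihilator q (e l) (x k)‖ ^ 2 :=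
        norm_sum_creator_sq_le_add q he x
    _ ≤ ∑ k, ‖x k‖ ^ 2 + |(q : ℝ)| * ∑ k, 1 / (1 - |(q : ℝ)|) * ‖x k‖ ^ 2 := by
        gcongr; exact h1 _
    -- `1 + |q| / (1 - |q|) = 1 / (1 - |q|)`.
    _ = _ := by rw [← Finset.mul_sum]; field_simp; ring

/-- The growth is only the square root of the number of terms, which beats division by that number
in an average. The absolute value of `C` matters for empty `ι`, where `hT` does not force `C` to be
nonnegative. -/
theorem norm_sum_creator_mul_le (he : Orthonormal ℂ e)
    (T : ι → FockSpace q H →L[ℂ] FockSpace q H) {C : ℝ} (hT : ∀ k, ‖T k‖ ≤ C) :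
    ‖∑ k, creator q (e k) * T k‖ ≤ √(Fintype.card ι / (1 - |(q : ℝ)|)) * |C| := by
  have h3 := one_sub_abs_pos q
  refine ContinuousLinearMap.opNorm_le_bound _ (by positivity) fun x => ?_
  refine (sq_le_sq₀ (norm_nonneg _) (by positivity)).1 ?_
  rw [mul_pow, mul_pow, Real.sq_sqrt (by positivity)]
  calc _ = ‖∑ k, creator q (e k) (T k x)‖ ^ 2 := by simp
    _ ≤ 1 / (1 - |(q : ℝ)|) * ∑ k, ‖T k x‖ ^ 2 := norm_sum_creator_sq_le q he _
    _ ≤ 1 / (1 - |(q : ℝ)|) * ∑ _k : ι, (|C| * ‖x‖) ^ 2 := by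
        gcongr with k
        exact ContinuousLinearMap.le_of_opNorm_le _ ((hT k).trans (le_abs_self C)) x
    _ = _ := by
        rw [Finset.sum_const, Finset.card_univ, nsmul_eq_mul]; ring

end RowEstimate

/-! ### Finite permutations moving a block to disjoint translates -/

section BlockSwap

/-- The permutation of `ℤ` exchanging the block `[-n, n]` with its `(k + 1)`-st translate. -/
def blockSwap (n k : ℕ) : Equiv.Perm ℤ :=
  -- The block has `2 * n + 1` points; the shift by `k + 1` blocks rather than `k` avoids the block
  -- itself when `k = 0`.
  let f : ℤ → ℤ := fun i => if -n ≤ i ∧ i ≤ n then i + (k + 1) * (2 * n + 1)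
    else if -n ≤ i - (k + 1) * (2 * n + 1) ∧ i - (k + 1) * (2 * n + 1) ≤ n then
      i - (k + 1) * (2 * n + 1)
    else i
  have hf : ∀ i, f (f i) = i := by
    intro i
    simp only [f]
    -- The shift is at least the length of the block, so the two blocks are disjoint and the
    -- exchange is an involution.
    have h : (2 * n + 1 : ℤ) ≤ (k + 1) * (2 * n + 1) := by
      nlinarith [mul_nonneg (Int.natCast_nonneg n) (Int.natCast_nonneg k)]
    generalize ((k : ℤ) + 1) * (2 * n + 1) = c at h
    grind
  ⟨f, f, hf, hf⟩

theorem blockSwap_of_mem {n : ℕ} (k : ℕ) {i : ℤ} (h : -n ≤ i ∧ i ≤ n) :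
    blockSwap n k i = i + (k + 1) * (2 * n + 1) := by
  simp [blockSwap, h]

theorem blockSwap_mem_finPerm (n k : ℕ) : blockSwap n k ∈ finPerm ℤ := by
  -- This interval contains both blocks, and the gap between them.
  refine (Set.finite_Icc (-n : ℤ) (n + (k + 1) * (2 * n + 1))).subset fun i hi => ?_
  have h : (2 * n + 1 : ℤ) ≤ (k + 1) * (2 * n + 1) := by
    nlinarith [mul_nonneg (Int.natCast_nonneg n) (Int.natCast_nonneg k)]
  by_contra hcon
  refine hi ?_
  rw [Set.mem_Icc] at hcon
  simp only [blockSwap, Equiv.coe_fn_mk]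
  generalize ((k : ℤ) + 1) * (2 * n + 1) = c at h hcon ⊢
  grind

/-- Distinct images of `i` give orthonormal basis vectors, as the row estimate requires. Working
with whole blocks makes this hold for all `|i| ≤ n` at once, so one sequence of averages serves all
words. -/
theorem blockSwap_injective {n : ℕ} {i : ℤ} (h : -n ≤ i ∧ i ≤ n) :
    Function.Injective fun k : ℕ => blockSwap n k i := by
  intro k l hkl
  simp only [blockSwap_of_mem _ h] at hkl
  have h1 : ((k : ℤ) + 1) * (2 * n + 1) = (l + 1) * (2 * n + 1) := by linarith
  have h2 := mul_right_cancel₀ (by positivity) h1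
  exact_mod_cast add_right_cancel h2

end BlockSwap

/-! ### Averages over permutations, Wick ordering and invariant states -/

section Averages

variable (q : Set.Ioo (-1 : ℝ) 1)

theorem basisVec_orthonormal : Orthonormal ℂ basisVec := by
  classical
  refine orthonormal_iff_ite.2 fun i j => ?_
  rw [basisVec, lp.inner_single_left]
  simp [basisVec, Pi.single_apply]

theorem norm_permAut_le (g : Equiv.Perm ℤ) (T : FockOp q) : ‖permAut q g T‖ ≤ ‖T‖ := by
  refine ContinuousLinearMap.opNorm_le_bound _ (norm_nonneg T) fun x => ?_
  rw [permAut, LinearIsometryEquiv.conjStarAlgEquiv_apply_apply, LinearIsometryEquiv.norm_map]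
  simpa using T.le_opNorm ((secondQuant q (permUnitary g)).symm x)

theorem permAut_creator_basisVec (g : Equiv.Perm ℤ) (i : ℤ) :
    permAut q g (creator q (basisVec i)) = creator q (basisVec (g i)) := by
  rw [permAut, conj_creator, permUnitary_basisVec]

/-- The average of the `n` automorphisms of the block permutations of `[-n, n]`. -/
def blockAverage (n : ℕ) : FockOp q →ₗ[ℂ] FockOp q :=
  (n : ℂ)⁻¹ • ∑ k : Fin n, (permAut q (blockSwap n k)).toAlgEquiv.toLinearMap

theorem blockAverage_apply (n : ℕ) (T : FockOp q) :
    blockAverage q n T = (n : ℂ)⁻¹ • ∑ k : Fin n, permAut q (blockSwap n k) T := by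
  simp [blockAverage]

theorem norm_blockAverage_le (n : ℕ) (T : FockOp q) : ‖blockAverage q n T‖ ≤ ‖T‖ := by
  rcases n.eq_zero_or_pos with rfl | hn
  · simp [blockAverage_apply]
  · rw [blockAverage_apply, norm_smul, norm_inv, Complex.norm_natCast,
      inv_mul_le_iff₀ (by exact_mod_cast hn)]
    refine (norm_sum_le_of_le _ fun k _ => norm_permAut_le q _ T).trans_eq ?_
    simp

theorem blockAverage_star (n : ℕ) (T : FockOp q) :
    blockAverage q n (star T) = star (blockAverage q n T) := by
  rw [blockAverage_apply, blockAverage_apply, star_smul, star_sum, star_inv₀, star_natCast]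
  exact congrArg _ (Finset.sum_congr rfl fun k _ => (permAut q (blockSwap n k)).map_star' T)

theorem blockAverage_one {n : ℕ} (hn : n ≠ 0) : blockAverage q n 1 = 1 := by
  have h : (n : ℂ) ≠ 0 := by exact_mod_cast hn
  rw [blockAverage_apply]
  simp only [map_one, Finset.sum_const, Finset.card_univ, Fintype.card_fin]
  rw [← Nat.cast_smul_eq_nsmul ℂ, smul_smul, inv_mul_cancel₀ h, one_smul]

/-- Each automorphism moves the creator to a new basis vector and does not increase the norm of the
second factor, so the row estimate applies to an arbitrary `T`. -/
theorem norm_blockAverage_creator_mul_le {n : ℕ} {i : ℤ} (h : -n ≤ i ∧ i ≤ n) (T : FockOp q) :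
    ‖blockAverage q n (creator q (basisVec i) * T)‖ ≤
      (n : ℝ)⁻¹ * (√(n / (1 - |(q : ℝ)|)) * ‖T‖) := by
  have he : Orthonormal ℂ fun k : Fin n => basisVec (blockSwap n k i) :=
    basisVec_orthonormal.comp _ ((blockSwap_injective h).comp Fin.val_injective)
  have h1 := norm_sum_creator_mul_le q he (fun k => permAut q (blockSwap n k) T)
    (fun k => norm_permAut_le q _ T)
  rw [Fintype.card_fin, abs_norm] at h1
  rw [blockAverage_apply, norm_smul, norm_inv, Complex.norm_natCast]
  simp only [map_mul, permAut_creator_basisVec]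
  gcongr

theorem tendsto_blockAverage_creator_mul (i : ℤ) (T : FockOp q) :
    Tendsto (fun n => blockAverage q n (creator q (basisVec i) * T)) atTop (𝓝 0) := by
  have h1 : Tendsto (fun n : ℕ => √((n : ℝ)⁻¹) * (√(1 / (1 - |(q : ℝ)|)) * ‖T‖)) atTop (𝓝 0) := by
    have := (Real.continuous_sqrt.tendsto 0).comp (tendsto_inv_atTop_nhds_zero_nat (𝕜 := ℝ))
    simpa using this.mul_const (√(1 / (1 - |(q : ℝ)|)) * ‖T‖)
  refine squeeze_zero_norm' ?_ h1
  -- From `n = |i|` on, the index `i` lies in the block; the bound is then a constant times `n⁻¹ √n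
  -- = √(n⁻¹)`.
  filter_upwards [eventually_ge_atTop (i.natAbs), eventually_gt_atTop 0] with n hn h0
  refine (norm_blockAverage_creator_mul_le q (by omega) T).trans_eq ?_
  have h0' : (0 : ℝ) < n := by exact_mod_cast h0
  rw [← mul_assoc, ← mul_assoc, div_eq_mul_one_div (n : ℝ), Real.sqrt_mul h0'.le, Real.sqrt_inv,
    ← mul_assoc]
  congr 2
  rw [inv_mul_eq_div, Real.sqrt_div_self', one_div]

/-- The operators whose block averages converge in norm to the vacuum expectation. -/
def mixingSubmodule : Submodule ℂ (FockOp q) where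
  carrier := {T | Tendsto (fun n => blockAverage q n T) atTop
    (𝓝 (inner ℂ (vacuum q L2Z) (T (vacuum q L2Z)) • (1 : FockOp q)))}
  zero_mem' := by simp
  add_mem' {S T} hS hT := by
    simpa [inner_add_right, add_smul] using Tendsto.add hS hT
  smul_mem' c T hT := by
    simpa [inner_smul_right, mul_smul] using Tendsto.const_smul hT c

theorem mem_mixingSubmodule {T : FockOp q} : T ∈ mixingSubmodule q ↔
    Tendsto (fun n => blockAverage q n T) atTop
      (𝓝 (inner ℂ (vacuum q L2Z) (T (vacuum q L2Z)) • (1 : FockOp q))) := Iff.rfl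

/-- An `ε / 3` argument: the averages are contractions uniformly in `n`, and so is the vacuum
expectation because `‖Ω‖ = 1`. -/
theorem isClosed_mixingSubmodule : IsClosed (mixingSubmodule q : Set (FockOp q)) := by
  refine isClosed_of_closure_subset fun T hT => ?_
  refine (mem_mixingSubmodule q).2 (Metric.tendsto_atTop.2 fun ε hε => ?_)
  have hv : ‖vacuum q L2Z‖ = 1 := by
    rw [norm_eq_sqrt_re_inner (𝕜 := ℂ), inner_vacuum_vacuum]; simp
  obtain ⟨S, hS, hTS⟩ := Metric.mem_closure_iff.1 hT (ε / 3) (by positivity)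
  rw [dist_eq_norm] at hTS
  obtain ⟨N, hN⟩ := Metric.tendsto_atTop.1 ((mem_mixingSubmodule q).1 hS) (ε / 3) (by positivity)
  refine ⟨N, fun n hn => ?_⟩
  have h1 := hN n hn
  rw [dist_eq_norm] at h1 ⊢
  have h2 : ‖blockAverage q n (T - S)‖ < ε / 3 := (norm_blockAverage_le q n _).trans_lt hTS
  have h3 : ‖inner ℂ (vacuum q L2Z) ((T - S) (vacuum q L2Z)) • (1 : FockOp q)‖ < ε / 3 := by
    refine lt_of_le_of_lt ?_ hTS
    calc _ ≤ ‖inner ℂ (vacuum q L2Z) ((T - S) (vacuum q L2Z))‖ * 1 := by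
          rw [norm_smul]
          gcongr
          exact ContinuousLinearMap.norm_id_le
      _ ≤ ‖vacuum q L2Z‖ * ‖(T - S) (vacuum q L2Z)‖ := by
          rw [mul_one]; exact norm_inner_le_norm _ _
      _ ≤ _ := by
          rw [hv, one_mul]
          simpa [hv] using (T - S).le_opNorm (vacuum q L2Z)
  have e : blockAverage q n T - inner ℂ (vacuum q L2Z) (T (vacuum q L2Z)) • (1 : FockOp q) =
      blockAverage q n (T - S) +
      (blockAverage q n S - inner ℂ (vacuum q L2Z) (S (vacuum q L2Z)) • (1 : FockOp q)) -
      inner ℂ (vacuum q L2Z) ((T - S) (vacuum q L2Z)) • (1 : FockOp q) := by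
    rw [map_sub, sub_apply, inner_sub_right, sub_smul]
    abel
  rw [e]
  refine (norm_sub_le _ _).trans_lt ?_
  linarith [norm_add_le (blockAverage q n (T - S))
    (blockAverage q n S - inner ℂ (vacuum q L2Z) (S (vacuum q L2Z)) • (1 : FockOp q))]

theorem star_mem_mixingSubmodule {T : FockOp q} (hT : T ∈ mixingSubmodule q) :
    star T ∈ mixingSubmodule q := by
  have h := ((mem_mixingSubmodule q).1 hT).star
  rw [mem_mixingSubmodule]
  simp only [blockAverage_star]
  convert h using 2
  rw [star_smul, star_one, ContinuousLinearMap.star_eq_adjoint,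
    ContinuousLinearMap.adjoint_inner_right, RCLike.star_def, inner_conj_symm]

theorem one_mem_mixingSubmodule : (1 : FockOp q) ∈ mixingSubmodule q := by
  rw [mem_mixingSubmodule, one_apply_eq_self, inner_vacuum_vacuum, one_smul]
  refine tendsto_const_nhds.congr' ?_
  filter_upwards [eventually_ne_atTop 0] with n hn
  rw [blockAverage_one q hn]

/-- The expectation vanishes since `a(f) Ω = 0`, which matches the limit of the averages when `f` is
a basis vector. General `f` follows by its norm-convergent basis expansion, as `f ↦ a†(f)` is
bounded and the subspace is closed. -/
theorem creator_mul_mem_mixingSubmodule (f : L2Z) (T : FockOp q) :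
    creator q f * T ∈ mixingSubmodule q := by
  have hi : ∀ i, creator q (basisVec i) * T ∈ mixingSubmodule q := by
    intro i
    rw [mem_mixingSubmodule, mul_apply_eq_comp, inner_creator_right,
      annihilator_vacuum, inner_zero_left, zero_smul]
    exact tendsto_blockAverage_creator_mul q i T
  have hf : HasSum (fun i => f i • basisVec i) f := by
    have h := lp.hasSum_single (p := 2) (by norm_num) f
    convert h using 2 with i
    rw [basisVec, ← lp.single_smul, smul_eq_mul, mul_one]
  have h : HasSum (fun i => creator q (f i • basisVec i) * T) (creator q f * T) :=
    ((creatorCLM q L2Z).hasSum hf).mul_right T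
  refine (isClosed_mixingSubmodule q).mem_of_tendsto h (Eventually.of_forall fun s => ?_)
  refine Submodule.sum_mem _ fun i _ => ?_
  rw [creator_smul, smul_mul_assoc]
  exact Submodule.smul_mem _ _ (hi i)

theorem mul_annihilator_mem_mixingSubmodule (f : L2Z) (T : FockOp q) :
    T * annihilator q f ∈ mixingSubmodule q := by
  have h := star_mem_mixingSubmodule q (creator_mul_mem_mixingSubmodule q f (star T))
  rwa [star_mul, star_star, star_creator] at h

/-- The linear span of the Wick ordered words in the creators and annihilators. -/
inductive IsWick : FockOp q → Prop
  | one : IsWick 1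
  | create (f : L2Z) {T : FockOp q} : IsWick T → IsWick (creator q f * T)
  | annihilate (f : L2Z) {T : FockOp q} : IsWick T → IsWick (T * annihilator q f)
  | add {S T : FockOp q} : IsWick S → IsWick T → IsWick (S + T)
  | smul (c : ℂ) {T : FockOp q} : IsWick T → IsWick (c • T)

variable {q}

/-- The annihilator travels to the right: passing a creator costs a factor `q` and leaves a shorter
Wick word with a scalar product, and in the end it joins the annihilators on the right. -/
theorem IsWick.annihilator_mul (f : L2Z) {T : FockOp q} (hT : IsWick q T) :
    IsWick q (annihilator q f * T) := by
  induction hT with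
  | one => simpa using IsWick.one.annihilate f
  | @create g T hT ih =>
    have h : annihilator q f * (creator q g * T) =
        inner ℂ f g • T + ((q : ℝ) : ℂ) • (creator q g * (annihilator q f * T)) :=
      ContinuousLinearMap.ext fun x => annihilator_creator_apply q f g (T x)
    rw [h]
    exact (hT.smul _).add ((ih.create g).smul _)
  | annihilate g _ ih => rw [← mul_assoc]; exact ih.annihilate g
  | add _ _ hS hT => rw [mul_add]; exact hS.add hT
  | smul c _ ih => rw [mul_smul_comm]; exact ih.smul c

theorem IsWick.mem_mixingSubmodule {T : FockOp q} (hT : IsWick q T) :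
    T ∈ mixingSubmodule q := by
  induction hT with
  | one => exact one_mem_mixingSubmodule q
  | create f _ _ => exact creator_mul_mem_mixingSubmodule q f _
  | annihilate f _ _ => exact mul_annihilator_mem_mixingSubmodule q f _
  | add _ _ hS hT => exact Submodule.add_mem _ hS hT
  | smul c _ ih => exact Submodule.smul_mem _ c ih

theorem isWick_of_mem_adjoin {T : FockOp q}
    (hT : T ∈ StarAlgebra.adjoin ℂ (Set.range fun f : L2Z => annihilator q f)) : IsWick q T := by
  -- Stating stability under left multiplication, for `T` and `star T` together, lets the induction
  -- pass through products and adjoints without multiplying two Wick words.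
  suffices h : (∀ S, IsWick q S → IsWick q (T * S)) ∧ ∀ S, IsWick q S → IsWick q (star T * S) by
    simpa using h.1 1 IsWick.one
  induction hT using StarAlgebra.adjoin_induction with
  | mem T hT =>
    obtain ⟨f, rfl⟩ := hT
    refine ⟨fun S hS => hS.annihilator_mul f, fun S hS => ?_⟩
    change IsWick q (star (annihilator q f) * S)
    rw [star_annihilator]
    exact hS.create f
  | algebraMap c =>
    refine ⟨fun S hS => ?_, fun S hS => ?_⟩
    · rw [← Algebra.smul_def]; exact hS.smul c
    · rw [← algebraMap_star_comm, ← Algebra.smul_def]; exact hS.smul _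
  | add T T' _ _ h h' =>
    refine ⟨fun S hS => ?_, fun S hS => ?_⟩
    · rw [add_mul]; exact (h.1 S hS).add (h'.1 S hS)
    · rw [star_add, add_mul]; exact (h.2 S hS).add (h'.2 S hS)
  | mul T T' _ _ h h' =>
    refine ⟨fun S hS => ?_, fun S hS => ?_⟩
    · rw [mul_assoc]; exact h.1 _ (h'.1 S hS)
    · rw [star_mul, mul_assoc]; exact h'.2 _ (h.2 S hS)
  | star T _ h => exact ⟨h.2, by simpa using h.1⟩

theorem mem_mixingSubmodule_of_mem_algR {T : FockOp q} (hT : T ∈ algR q) :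
    T ∈ mixingSubmodule q :=
  (isClosed_mixingSubmodule q).closure_subset_iff.2
    (fun _ hS => (isWick_of_mem_adjoin hS).mem_mixingSubmodule) hT

variable (q)

theorem generated_le_algR {S : Set (FockOp q)} (h : S ⊆ algR q) : generated q S ≤ algR q :=
  StarSubalgebra.topologicalClosure_minimal (StarAlgebra.adjoin_le h)
    (StarSubalgebra.isClosed_topologicalClosure _)

theorem fieldOp_mem_algR (f : L2Z) : fieldOp q f ∈ algR q := by
  have h : annihilator q f ∈ algR q :=
    StarSubalgebra.le_topologicalClosure _ (StarAlgebra.subset_adjoin ℂ _ ⟨f, rfl⟩)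
  rw [fieldOp, ← star_annihilator]
  exact add_mem h (star_mem h)

/-- Positivity is `‖T Ω‖² ≥ 0`; invariance holds because every second quantization fixes `Ω`. -/
theorem vacuumState_mem_symmetricStates {A : StarSubalgebra ℂ (FockOp q)}
    (hA : PermStable q A) : vacuumState q A ∈ symmetricStates q hA := by
  have happ : ∀ T : A, vacuumState q A T =
      inner ℂ (vacuum q L2Z) ((T : FockOp q) (vacuum q L2Z)) := fun _ => rfl
  refine ⟨⟨fun T => ?_, ?_⟩, fun g _ T => ?_⟩
  · rw [happ]
    change 0 ≤ inner ℂ (vacuum q L2Z) ((star (T : FockOp q) * (T : FockOp q)) (vacuum q L2Z))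
    rw [mul_apply_eq_comp, ContinuousLinearMap.star_eq_adjoint,
      ContinuousLinearMap.adjoint_inner_right, inner_self_eq_norm_sq_to_K]
    simp
  · rw [happ]
    exact inner_vacuum_vacuum q L2Z
  · rw [happ, happ]
    change inner ℂ (vacuum q L2Z) (permAut q g (T : FockOp q) (vacuum q L2Z)) = _
    rw [permAut, LinearIsometryEquiv.conjStarAlgEquiv_apply_apply, secondQuant_symm,
      secondQuant_vacuum]
    -- Writing `Ω` as its own image lets the unitary cancel from the inner product.
    conv_lhs => rw [← secondQuant_vacuum q (permUnitary g)]
    rw [LinearIsometryEquiv.inner_map_map, secondQuant_vacuum]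

theorem symmetricStates_eq_singleton {A : StarSubalgebra ℂ (FockOp q)} (hA : PermStable q A)
    (hle : A ≤ algR q) : symmetricStates q hA = {vacuumState q A} := by
  refine Set.eq_singleton_iff_unique_mem.2 ⟨vacuumState_mem_symmetricStates q hA, ?_⟩
  rintro φ ⟨⟨-, h1⟩, hφ⟩
  refine ContinuousLinearMap.ext fun T => ?_
  have hT := (mem_mixingSubmodule q).1 (mem_mixingSubmodule_of_mem_algR (hle T.2))
  -- The averages are formed inside `A`, where `φ` is defined; the topology is the induced one, so
  -- convergence in `FockOp q` is enough.
  have h2 : Tendsto (fun n : ℕ => (n : ℂ)⁻¹ • ∑ k : Fin n, restrictAut q hA (blockSwap n k) T)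
      atTop (𝓝 (vacuumState q A T • (1 : A))) := by
    rw [tendsto_subtype_rng]
    refine hT.congr fun n => ?_
    rw [blockAverage_apply, SetLike.val_smul, AddSubmonoidClass.coe_finsetSum]
    -- The restricted automorphisms act by `permAut` on the underlying operators.
    rfl
  have h3 := (φ.continuous.tendsto _).comp h2
  rw [map_smul, h1, smul_eq_mul, mul_one] at h3
  refine tendsto_nhds_unique (tendsto_const_nhds.congr' ?_) h3
  -- For `n ≠ 0` the state takes the constant value `φ T` on the averages; the empty average is `0`
  -- and is discarded.
  filter_upwards [eventually_ne_atTop 0] with n hn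
  have h : (n : ℂ) ≠ 0 := by exact_mod_cast hn
  simp only [Function.comp_apply, map_smul, map_sum, hφ _ (blockSwap_mem_finPerm _ _) T]
  simp [h]

end Averages

end QFock

end

theorem mainTheorem5 (q : Set.Ioo (-1 : ℝ) 1) :
    QFock.symmetricStates q (QFock.permStable_algR q) = {QFock.vacuumState q (QFock.algR q)} ∧
    QFock.symmetricStates q (QFock.permStable_algG q) = {QFock.vacuumState q (QFock.algG q)} ∧
    QFock.symmetricStates q (QFock.permStable_algGReal q) =
      {QFock.vacuumState q (QFock.algGReal q)} := by
  -- Since `s(f) = a(f) + a(f)*`, the generators of the two smaller algebras lie in `algR q`.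
  refine ⟨QFock.symmetricStates_eq_singleton q _ le_rfl,
    QFock.symmetricStates_eq_singleton q _ (QFock.generated_le_algR q ?_),
    QFock.symmetricStates_eq_singleton q _ (QFock.generated_le_algR q ?_)⟩
  · rintro _ ⟨f, rfl⟩
    exact QFock.fieldOp_mem_algR q f
  · rintro _ ⟨i, rfl⟩
    exact QFock.fieldOp_mem_algR q _
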